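/- Let $n\ge 5$. For a finite word $u$, $|u|$ is its length and $\mathrm{per}(u)$ its least positive period. Let $\mathbf T_m$ be the set of threshold words over an $m$-letter alphabet $\mathbf A_m$: the finite words all of whose nonempty factors $u$ satisfy $|u|/\mathrm{per}(u)\le m/(m-1)$. Let $\mathbf D^{\varepsilon}_{3,n}$ be the set of words over $\mathbf A_n$ all of whose factors $u$ with $\mathrm{per}(u)\ge 3n-3$ satisfy $(|u|+\varepsilon)/\mathrm{per}(u)\le n/(n-1)$. Let $V$ be a finite set of words of length $L$ over $\mathbf A_n$; let $l(V)$ and $r(V)$ be the greatest lengths of a common prefix, respectively common suffix, of two different words of $V$, and in part (A) put $\varepsilon=(l(V)+r(V))/(L-1)$. In both parts some words of $V$ are assigned as images to letters; one assigned word $v$ (an image of a letter $b$) is called replaceable, and one word $v'\in V$ that is not assigned is its alternative. For a letter $a$ let $V_a$ be the set of images of $a$, where $v'$ is also counted in $V_b$. For a real $\delta$ let $\mathrm{(C)}_\delta$ be the condition: for every letter $a$, all $x,x'\in V_a$ and all different $u,w\in V\setminus V_a$, if $u$ and $x$ have a common prefix of length $l$, and $x'$ and $w$ have a common suffix of length $r$,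 then $\delta+l+r\le L/(n-1)$. (A) Suppose $|V|\ge 3n+1$, $L\ge 6(n-1)$, $\mathrm{per}(u)=L$ for all $u\in V$, $uw\in\mathbf D^{\varepsilon}_{3,n}\cap\mathbf T_n$ for all different $u,w\in V$; each letter $a\in\mathbf A_n$ has three images $v_{a,1},v_{a,2},v_{a,3}\in V$, all $3n$ of them different; and $\mathrm{(C)}_\varepsilon$ holds. Let $f$ be the substitution that replaces the $j$-th occurrence of each letter $a$ in a word by $v_{a,i}$ with $i\in\{1,2,3\}$, $i\equiv j \pmod 3$. Then for every word $w\in\mathbf D^{\varepsilon}_{3,n}\cap\mathbf T_n$, replacing $v$ by $v'$ in $f(w)$ at the letters of $w$ in any subset of those whose image is $v$ gives a word of $\mathbf D^{\varepsilon}_{3,n}\cap\mathbf T_n$. (B) Suppose $k\ge 1$, $|V|\ge n+k+1$, $\mathrm{per}(u)=L$ for all $u\in V$, $uw\in\mathbf T_n$ for all different $u,w\in V$; $l+r\le L/(n-1)$ whenever $x,y,z\in V$ are pairwise different, $x,y$ have a common suffix of length $l$ and $y,z$ have a common prefix of length $r$; each letter of $\mathbf A_{n+k}$ has one image in $V$,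 different letters having different images; and $\mathrm{(C)}_0$ holds. Let $f$ be the corresponding morphism. Then for every $w\in\mathbf T_{n+k}$, replacing $v$ by $v'$ in $f(w)$ at the letters of $w$ in any subset of those whose image is $v$ gives a word of $\mathbf T_n$. Moreover, let $\omega$ be a right-infinite word all of whose finite prefixes belong to $\mathbf D^{\varepsilon}_{3,n}\cap\mathbf T_n$ in case (A), to $\mathbf T_{n+k}$ in case (B). Let $\mathcal T$ be the tree whose vertices are all prefixes of the words obtained from $f(p)$, $p$ a finite prefix of $\omega$, by all such replacements, ordered by the prefix relation. Then all vertices of $\mathcal T$ belong to $\mathbf D^{\varepsilon}_{3,n}\cap\mathbf T_n$, respectively to $\mathbf T_n$. Put $(c,C)=((3n-3)L,(3n+3)L)$ in case (A) and $(c,C)=((n+k-1)L,(n+k+1)L)$ in case (B). Call a vertex of $\mathcal T$ branching if it has at least two one-letter extensions in $\mathcal T$, and call branching vertices $x\ne y$ neighbouring if $x$ is a prefix of $y$ and no other branching vertex lies between them. Then every vertex $x$ is a prefix of a branching vertex $y$ with $|y|<|x|+C$; neighbouring branching vertices satisfy $c\le |y|-|x|\le C$; and for every $m$ the tree has at least $2^{\lfloor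 m/C\rfloor}$ vertices of length $m$ (exponential growth). -/

import Mathlib

namespace ThresholdWords

/-- The period `per(w)`: the least positive period of `w`. -/
noncomputable def per {α : Type*} (w : List α) : ℕ :=
  sInf {p : ℕ | 0 < p ∧ w.HasPeriod p}

/-- The threshold words over `n` letters: every nonempty factor has exponent
`|u| / per(u)` at most `n / (n - 1)`. -/
def threshold (n : ℕ) : Set (List (Fin n)) :=
  {w | ∀ u : List (Fin n), u <:+: w → u ≠ [] →
    (u.length : ℝ) / (per u : ℝ) ≤ (n : ℝ) / ((n : ℝ) - 1)}

/-- The words over `n` letters all of whose nonempty factors `u` with `per(u) ∈ P` satisfy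
`(|u| + ε) / per(u) ≤ n / (n - 1)`. -/
def epsBounded (n : ℕ) (ε : ℝ) (P : Set ℕ) : Set (List (Fin n)) :=
  {w | ∀ u : List (Fin n), u <:+: w → u ≠ [] → per u ∈ P →
    ((u.length : ℝ) + ε) / (per u : ℝ) ≤ (n : ℝ) / ((n : ℝ) - 1)}

/-- `D^ε_{3,n} ∩ T_n`, where `D^ε_{3,n}` constrains the factors of period at least `3n - 3`. -/
def epsThreshold (n : ℕ) (ε : ℝ) : Set (List (Fin n)) :=
  epsBounded n ε {p : ℕ | 3 * (n - 1) ≤ p} ∩ threshold n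

/-- `l(V)`: the greatest length of a common prefix of two different words of `V`. -/
noncomputable def maxCommonPrefix {α : Type*} (V : Finset (List α)) : ℕ :=
  sSup {m : ℕ | ∃ u ∈ V, ∃ v ∈ V, u ≠ v ∧ ∃ x : List α, x <+: u ∧ x <+: v ∧ x.length = m}

/-- `r(V)`: the greatest length of a common suffix of two different words of `V`. -/
noncomputable def maxCommonSuffix {α : Type*} (V : Finset (List α)) : ℕ :=
  sSup {m : ℕ | ∃ u ∈ V, ∃ v ∈ V, u ≠ v ∧ ∃ x : List α, x <:+ u ∧ x <:+ v ∧ x.length = m}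

/-- `ε = (l(V) + r(V)) / (L - 1)`. -/
noncomputable def eps {α : Type*} (V : Finset (List α)) (L : ℕ) : ℝ :=
  ((maxCommonPrefix V : ℝ) + (maxCommonSuffix V : ℝ)) / ((L : ℝ) - 1)

/-- The images of the letter `a` once the image `v` may be replaced by `v'`: the original images
`I a`, together with `v'` if `v` is one of them. -/
def imagesWith {α β : Type*} (I : α → Set (List β)) (v v' : List β) (a : α) : Set (List β) :=
  {x | x ∈ I a ∨ (x = v' ∧ v ∈ I a)}

/-- For every letter `a` with image set `J a`, all `x, x' ∈ J a` and all different `u, w ∈ V`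
outside `J a`: a common prefix of `u` and `x` and a common suffix of `x'` and `w` have
lengths `l`, `r` with `ε + l + r ≤ L / (n - 1)`. -/
def OverlapCondition {α : Type*} (n L : ℕ) (ε : ℝ) (V : Finset (List (Fin n)))
    (J : α → Set (List (Fin n))) : Prop :=
  ∀ a : α, ∀ u ∈ V, u ∉ J a → ∀ w ∈ V, w ∉ J a → u ≠ w → ∀ x ∈ J a, ∀ x' ∈ J a,
    ∀ p s : List (Fin n), p <+: u → p <+: x → s <:+ x' → s <:+ w →
      ε + ((p.length : ℝ) + (s.length : ℝ)) ≤ (L : ℝ) / ((n : ℝ) - 1)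

/-- The conditions of the three-valued (context-dependent) substitution on a set `V` of words
of length `L`, where `J a` is the set of images of the letter `a`. -/
structure CyclicConditions (n L : ℕ) (V : Finset (List (Fin n)))
    (J : Fin n → Set (List (Fin n))) : Prop where
  length_ge : 6 * (n - 1) ≤ L
  length_eq : ∀ v ∈ V, v.length = L
  per_eq : ∀ v ∈ V, per v = v.length
  pair : ∀ u ∈ V, ∀ v ∈ V, u ≠ v → u ++ v ∈ epsThreshold n (eps V L)
  overlap : OverlapCondition n L (eps V L) V J

/-- The conditions of the uniform morphism on a set `V` of words of length `L`. -/
structure MorphismConditions (n L : ℕ) (V : Finset (List (Fin n))) : Prop where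
  length_eq : ∀ v ∈ V, v.length = L
  per_eq : ∀ v ∈ V, per v = v.length
  pair : ∀ u ∈ V, ∀ v ∈ V, u ≠ v → u ++ v ∈ threshold n
  triple : ∀ u ∈ V, ∀ v ∈ V, ∀ w ∈ V, u ≠ v → v ≠ w → u ≠ w →
    ∀ s p : List (Fin n), s <:+ u → s <:+ v → p <+: v → p <+: w →
      (s.length : ℝ) + (p.length : ℝ) ≤ (L : ℝ) / ((n : ℝ) - 1)

/-- Context-dependent substitution: `F u a` is the image of a letter `a` preceded by the word `u`;
`substFrom F u w` is the image of `w` when `w` is preceded by `u`. -/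
def substFrom {α β : Type*} (F : List α → α → List β) : List α → List α → List β
  | _, [] => []
  | u, a :: w => F u a ++ substFrom F (u ++ [a]) w

/-- The image of the word `w`. -/
def subst {α β : Type*} (F : List α → α → List β) (w : List α) : List β :=
  substFrom F [] w

/-- The three images of each letter are used in cyclic order along the occurrences of the letter. -/
def cyclicRule {α β : Type*} [DecidableEq α] (im : α → Fin 3 → List β) (u : List α) (a : α) :
    List β :=
  im a ⟨u.count a % 3, Nat.mod_lt _ (by norm_num)⟩

/-- The rule of an ordinary morphism `f`. -/
def morphismRule {α β : Type*} (f : α → List β) (_u : List α) (a : α) : List β :=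
  f a

open Classical in
/-- The rule `F` with the image `v` replaced by `v'` at those of its occurrences whose position
in the preimage belongs to `S`. -/
noncomputable def replaceRule {α β : Type*} (F : List α → α → List β) (v v' : List β)
    (S : Set ℕ) (u : List α) (a : α) : List β :=
  if F u a = v ∧ u.length ∈ S then v' else F u a

/-- The prefix of length `m` of the infinite word `ω`. -/
def initialWord {α : Type*} (ω : ℕ → α) (m : ℕ) : List α :=
  (List.range m).map ω

/-- The tree of all words obtained from the infinite word `ω` by replacing `v` by `v'` at arbitrary
sets of occurrences: its vertices are the prefixes of the images, ordered by extension. -/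
def replacementTree {α β : Type*} (F : List α → α → List β) (v v' : List β) (ω : ℕ → α) :
    Set (List β) :=
  {x | ∃ (S : Set ℕ) (m : ℕ), x <+: subst (replaceRule F v v' S) (initialWord ω m)}

/-- A branching vertex of a tree of words: a vertex with at least two children. -/
def IsBranching {β : Type*} (T : Set (List β)) (x : List β) : Prop :=
  ∃ c d : β, c ≠ d ∧ x ++ [c] ∈ T ∧ x ++ [d] ∈ T

/-- `y` is the next branching vertex above the branching vertex `x` on some branch. -/
def AreNeighbours {β : Type*} (T : Set (List β)) (x y : List β) : Prop :=
  IsBranching T x ∧ IsBranching T y ∧ x <+: y ∧ x ≠ y ∧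
    ∀ z : List β, IsBranching T z → x <+: z → z <+: y → z = x ∨ z = y

/-- Every vertex has a branching vertex less than `hi` letters above it, neighbouring branching
vertices are at distance at least `lo` and at most `hi`, and the tree grows exponentially:
there are at least `2 ^ ⌊m / hi⌋` vertices of depth `m`. -/
structure UniformlyGrowing {β : Type*} (T : Set (List β)) (lo hi : ℕ) : Prop where
  branches : ∀ x ∈ T, ∃ y : List β, IsBranching T y ∧ x <+: y ∧ y.length < x.length + hi
  distance : ∀ x y : List β, AreNeighbours T x y →
    x.length + lo ≤ y.length ∧ y.length ≤ x.length + hi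
  growth : ∀ m : ℕ, 2 ^ (m / hi) ≤ {x : List β | x ∈ T ∧ x.length = m}.ncard

end ThresholdWords

/-!
A word lies in `T_n` if and only if each repetition in it, that is, each pair of occurrences of a
factor of length `q` at distance `p`, satisfies `(n - 1) q ≤ p`; in `D^ε_{3,n}` the same holds with
`q + ε` in place of `q` when `p ≥ 3n - 3`.

In an image word, a product of blocks of length `L`, a repetition at a distance not divisible by
`L` overlays differently placed blocks. As the products of two different blocks are threshold
words, the repeated factor is then too short to contain much of a block, and the bound holds. At a
distance `kL` the repeated factor consists of `d` complete blocks between an incomplete block `x`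
and an incomplete block `y`, where `x` and `y` are a common suffix and a common prefix of two
different blocks. If `d = 0`, only `x` and `y` remain and the overlap condition bounds
`|x| + |y|`. If `d > 0`, equal blocks are images of the same letter even after replacements, so the
preimage contains a repetition of length `d` at distance `k`. In part (A) equal blocks also have
equal occurrence numbers modulo `3`, whence `k ≥ 3n - 3` and `(n - 1)(d + ε) ≤ k`, and
`ε (L - 1) = l(V) + r(V)` absorbs `x` and `y`. In part (B) `(n + k₀ - 1) d ≤ k` leaves room for `x`
and `y`, except when `k₀ = d = 1` and `k = n`. In that case the letters of the preimage on both
sides of the repetition agree, and the overlap condition applies again.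

The branching levels of the tree are the positions `cL + δ`, where the `c`-th block is `v` and `δ`
is the first position at which `v` and `v'` differ. Consecutive occurrences of a letter in a
threshold word over `M` letters are at distance at least `M - 1` and every `M + 1` successive
letters contain all letters, so the gaps between these levels are controlled.
-/

namespace ThresholdWords

section Repetitions

variable {α : Type*} {u w : List α} {i p q : ℕ}

theorem per_spec (hu : u ≠ []) : 0 < per u ∧ u.HasPeriod (per u) :=
  Nat.sInf_mem (s := {p | 0 < p ∧ u.HasPeriod p})
    ⟨u.length, List.length_pos_iff.2 hu, List.hasPeriod_of_length_le _ _ le_rfl⟩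

theorem per_le (hp : 0 < p) (h : u.HasPeriod p) : per u ≤ p :=
  Nat.sInf_le ⟨hp, h⟩

theorem per_le_length (hu : u ≠ []) : per u ≤ u.length :=
  per_le (List.length_pos_iff.2 hu) (List.hasPeriod_of_length_le _ _ le_rfl)

/-- A repetition of period `p` in `w`: the factors of length `q` at `i` and at `i + p` agree. Thus
`q` is the excess of the length over the period, and it may be `0`. -/
def IsRepetition (w : List α) (i p q : ℕ) : Prop :=
  i + p + q ≤ w.length ∧ ∀ t < q, w[i + t]? = w[i + p + t]?

theorem exists_isRepetition_of_infix (h : u <:+: w) (hp : u.HasPeriod p) (hle : p ≤ u.length) :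
    ∃ i, IsRepetition w i p (u.length - p) := by
  obtain ⟨s, r, rfl⟩ := h
  have hget : ∀ t < u.length, (s ++ u ++ r)[s.length + t]? = u[t]? := fun t ht => by
    rw [List.append_assoc, List.getElem?_append_right (by omega), Nat.add_sub_cancel_left,
      List.getElem?_append_left ht]
  refine ⟨s.length, by simp; omega, fun t ht => ?_⟩
  rw [hget t (by omega), add_assoc, hget _ (by omega), add_comm p t,
    List.hasPeriod_iff_getElem?.1 hp t ht]

theorem IsRepetition.exists_infix (h : IsRepetition w i p q) :
    ∃ u, u <:+: w ∧ u.length = p + q ∧ u.HasPeriod p := by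
  obtain ⟨hlen, hget⟩ := h
  have hfactor : ((w.drop i).take (p + q)).length = p + q := by
    rw [List.length_take, List.length_drop]; omega
  refine ⟨(w.drop i).take (p + q), (List.take_prefix _ _).isInfix.trans
    (List.drop_suffix _ _).isInfix, hfactor, List.hasPeriod_iff_getElem?.2 fun t ht => ?_⟩
  rw [List.getElem?_take, List.getElem?_take, if_pos (by omega), if_pos (by omega),
    List.getElem?_drop, List.getElem?_drop, hget t (by omega), add_right_comm, add_assoc]

/-- The bound which `epsThreshold n ε` imposes on a repetition of period `p` whose repeated part
has length `q`. -/
def Admissible (n : ℕ) (ε : ℝ) (p q : ℕ) : Prop :=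
  ((n : ℝ) - 1) * q ≤ p ∧ (3 * (n - 1) ≤ p → ((n : ℝ) - 1) * (q + ε) ≤ p)

end Repetitions

section Threshold

variable {n p : ℕ} {ε : ℝ} {u w : List (Fin n)}

theorem div_le_div_sub_one_iff (hn : 2 ≤ n) (hp : 0 < p) (x : ℝ) :
    x / (p : ℝ) ≤ (n : ℝ) / ((n : ℝ) - 1) ↔ ((n : ℝ) - 1) * (x - p) ≤ p := by
  have hn' : (2 : ℝ) ≤ n := by exact_mod_cast hn
  have hp' : (0 : ℝ) < p := by exact_mod_cast hp
  rw [div_le_div_iff₀ hp' (by linarith)]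
  constructor <;> intro h <;> linarith

theorem mem_threshold_iff (hn : 2 ≤ n) :
    w ∈ threshold n ↔ ∀ i p q, 0 < p → IsRepetition w i p q → ((n : ℝ) - 1) * q ≤ p := by
  have hn' : (2 : ℝ) ≤ n := by exact_mod_cast hn
  constructor
  · intro h i p q hp hr
    obtain ⟨u, hu, hlen, hper⟩ := hr.exists_infix
    have hne : u ≠ [] := List.ne_nil_of_length_pos (by omega)
    have hexp := h u hu hne
    rw [div_le_div_sub_one_iff hn (per_spec hne).1, hlen] at hexp
    have hle : (per u : ℝ) ≤ p := by exact_mod_cast per_le hp hper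
    push_cast at hexp
    nlinarith [hn', hle]
  · intro h u hu hne
    obtain ⟨hpos, hper⟩ := per_spec hne
    obtain ⟨i, hr⟩ := exists_isRepetition_of_infix hu hper (per_le_length hne)
    rw [div_le_div_sub_one_iff hn hpos, ← Nat.cast_sub (per_le_length hne)]
    exact h i _ _ hpos hr

theorem natCast_three_mul_sub_one (hn : 1 ≤ n) :
    ((3 * (n - 1) : ℕ) : ℝ) = 3 * ((n : ℝ) - 1) := by
  push_cast [hn]; ring

theorem threshold_of_infix (h : u <:+: w) (hw : w ∈ threshold n) : u ∈ threshold n :=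
  fun x hx => hw x (hx.trans h)

theorem epsThreshold_of_infix (h : u <:+: w) (hw : w ∈ epsThreshold n ε) :
    u ∈ epsThreshold n ε :=
  ⟨fun x hx => hw.1 x (hx.trans h), threshold_of_infix h hw.2⟩

/-- Otherwise `u` has length `p + 1` and least period `p - 1`, so its first two letters agree. -/
theorem le_per_of_hasPeriod (hn : 3 ≤ n) (hu : u ∈ threshold n) (hper : u.HasPeriod p)
    (hlt : p < u.length) (hp : 3 * (n - 1) ≤ p) : 3 * (n - 1) ≤ per u := by
  by_contra! hlow
  have hn' : (3 : ℝ) ≤ n := by exact_mod_cast hn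
  have hne : u ≠ [] := List.ne_nil_of_length_pos (by omega)
  obtain ⟨hpos, hper'⟩ := per_spec hne
  rw [mem_threshold_iff (by omega)] at hu
  have hexcess : u.length - per u < 3 := by
    obtain ⟨i, hr⟩ := exists_isRepetition_of_infix List.infix_rfl hper' (per_le_length hne)
    have hbound := hu i _ _ hpos hr
    have hlow' : (per u : ℝ) < 3 * ((n : ℝ) - 1) := by
      rw [← natCast_three_mul_sub_one (by omega)]; exact_mod_cast hlow
    by_contra! hge
    have hge' : (3 : ℝ) ≤ (u.length - per u : ℕ) := by exact_mod_cast hge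
    nlinarith
  have hfirst : u[0]? = u[1]? := by
    rw [List.hasPeriod_iff_getElem?.1 hper 0 (by omega),
      List.hasPeriod_iff_getElem?.1 hper' 1 (by omega), show 0 + p = 1 + per u by omega]
  have hone := hu 0 1 1 one_pos ⟨by omega, fun t ht => by
    obtain rfl : t = 0 := by omega
    exact hfirst⟩
  push_cast at hone
  linarith

theorem mem_epsThreshold_iff (hn : 3 ≤ n) (hε : ε ≤ 1) :
    w ∈ epsThreshold n ε ↔ ∀ i p q, 0 < p → IsRepetition w i p q → Admissible n ε p q := by
  have hn' : (3 : ℝ) ≤ n := by exact_mod_cast hn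
  constructor
  · rintro ⟨hE, hT⟩ i p q hp hr
    refine ⟨(mem_threshold_iff (by omega)).1 hT i p q hp hr, fun h3 => ?_⟩
    rcases Nat.eq_zero_or_pos q with rfl | hq
    · have h3' : (3 : ℝ) * ((n : ℝ) - 1) ≤ p := by
        rw [← natCast_three_mul_sub_one (by omega)]; exact_mod_cast h3
      push_cast
      nlinarith
    obtain ⟨u, hu, hlen, hper⟩ := hr.exists_infix
    have hne : u ≠ [] := List.ne_nil_of_length_pos (by omega)
    have hexp := hE u hu hne
      (le_per_of_hasPeriod hn (threshold_of_infix hu hT) hper (by omega) h3)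
    rw [div_le_div_sub_one_iff (by omega) (per_spec hne).1, hlen] at hexp
    have hle : (per u : ℝ) ≤ p := by exact_mod_cast per_le hp hper
    push_cast at hexp
    nlinarith
  · intro h
    refine ⟨fun u hu hne hP => ?_, (mem_threshold_iff (by omega)).2
      fun i p q hp hr => (h i p q hp hr).1⟩
    obtain ⟨hpos, hper⟩ := per_spec hne
    obtain ⟨i, hr⟩ := exists_isRepetition_of_infix hu hper (per_le_length hne)
    rw [div_le_div_sub_one_iff (by omega) hpos, add_sub_right_comm,
      ← Nat.cast_sub (per_le_length hne)]
    exact (h i _ _ hpos hr).2 hP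

theorem epsThreshold_zero (n : ℕ) : epsThreshold n 0 = threshold n :=
  Set.inter_eq_right.2 fun w hw u hu hne _ => by simpa only [add_zero] using hw u hu hne

end Threshold

/-- A set of words of length `L`, none of which has a shorter period, such that the product of two
different ones belongs to `epsThreshold n ε`. -/
structure IsBlockCode (n L : ℕ) (ε : ℝ) (V : Finset (List (Fin n))) : Prop where
  three_le : 3 ≤ n
  eps_nonneg : 0 ≤ ε
  eps_le_one : ε ≤ 1
  eps_eq_zero_or : ε = 0 ∨ 6 * (n - 1) ≤ L
  nontrivial : V.Nontrivial
  length_eq : ∀ v ∈ V, v.length = L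
  per_eq : ∀ v ∈ V, per v = v.length
  pair : ∀ u ∈ V, ∀ v ∈ V, u ≠ v → u ++ v ∈ epsThreshold n ε

namespace IsBlockCode

variable {n L d i j p q : ℕ} {ε : ℝ} {V : Finset (List (Fin n))} {u v x y z : List (Fin n)}

theorem pos (h : IsBlockCode n L ε V) : 0 < L := by
  refine Nat.pos_of_ne_zero fun hL => ?_
  obtain ⟨u, hu, v, hv, huv⟩ := h.nontrivial
  refine huv ?_
  rw [List.eq_nil_of_length_eq_zero ((h.length_eq u hu).trans hL),
    List.eq_nil_of_length_eq_zero ((h.length_eq v hv).trans hL)]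

theorem two_le_sub_one (h : IsBlockCode n L ε V) : (2 : ℝ) ≤ (n : ℝ) - 1 := by
  have hn : (3 : ℝ) ≤ n := by exact_mod_cast h.three_le
  linarith

theorem eps_eq_zero_or_mul_le (h : IsBlockCode n L ε V) : ε = 0 ∨ 6 * ((n : ℝ) - 1) ≤ L := by
  refine h.eps_eq_zero_or.imp_right fun hL => ?_
  have hthree := natCast_three_mul_sub_one (n := n) (by have := h.three_le; omega)
  have hL' : (2 : ℝ) * ((3 * (n - 1) : ℕ) : ℝ) ≤ L := by exact_mod_cast (by omega)
  linarith

theorem mul_eps_le (h : IsBlockCode n L ε V) : ((n : ℝ) - 1) * ε ≤ L := by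
  have htwo := h.two_le_sub_one
  rcases h.eps_eq_zero_or_mul_le with rfl | hL
  · rw [mul_zero]; positivity
  · nlinarith [h.eps_le_one]

theorem length_append (h : IsBlockCode n L ε V) (hu : u ∈ V) (hv : v ∈ V) :
    (u ++ v).length = 2 * L := by
  rw [List.length_append, h.length_eq u hu, h.length_eq v hv, two_mul]

theorem getElem?_append_of_lt (h : IsBlockCode n L ε V) (hu : u ∈ V) (hi : i < L) :
    (u ++ v)[i]? = u[i]? :=
  List.getElem?_append_left (by rwa [h.length_eq u hu])

theorem getElem?_append_add (h : IsBlockCode n L ε V) (hu : u ∈ V) (i : ℕ) :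
    (u ++ v)[L + i]? = v[i]? := by
  rw [List.getElem?_append_right (by rw [h.length_eq u hu]; omega), h.length_eq u hu,
    Nat.add_sub_cancel_left]

theorem admissible_of_isRepetition (h : IsBlockCode n L ε V) (hu : u ∈ V) (hv : v ∈ V)
    (huv : u ≠ v) (hp : 0 < p) (hr : IsRepetition (u ++ v) i p q) : Admissible n ε p q :=
  (mem_epsThreshold_iff h.three_le h.eps_le_one).1 (h.pair u hu v hv huv) i p q hp hr

theorem admissible_of_common_factor (h : IsBlockCode n L ε V) (hu : u ∈ V) (hv : v ∈ V)
    (huv : u ≠ v) (hij : i < L + j) (hi : i + q ≤ L) (hj : j + q ≤ L)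
    (he : ∀ t < q, u[i + t]? = v[j + t]?) : Admissible n ε (L + j - i) q := by
  refine h.admissible_of_isRepetition hu hv huv (i := i) (by omega)
    ⟨by rw [h.length_append hu hv]; omega, fun t ht => ?_⟩
  rw [h.getElem?_append_of_lt hu (by omega), he t ht,
    show i + (L + j - i) + t = L + (j + t) by omega, h.getElem?_append_add hu]

theorem mul_le_of_admissible (h : IsBlockCode n L ε V) (hd : d ≤ L)
    (ha : Admissible n ε d q) : ((n : ℝ) - 1) * (q + ε) ≤ L := by
  have htwo := h.two_le_sub_one
  have hdL : (d : ℝ) ≤ L := by exact_mod_cast hd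
  rcases h.eps_eq_zero_or_mul_le with rfl | hL
  · rw [add_zero]
    exact ha.1.trans hdL
  by_cases hlong : 3 * (n - 1) ≤ d
  · exact (ha.2 hlong).trans hdL
  · have hshort : (d : ℝ) < 3 * ((n : ℝ) - 1) := by
      rw [← natCast_three_mul_sub_one (by have := h.three_le; omega)]
      exact_mod_cast not_le.1 hlong
    have hq : (q : ℝ) < (3 : ℕ) := by
      by_contra! hq
      push_cast at hq
      nlinarith [ha.1]
    have hq' : (q : ℝ) ≤ (2 : ℕ) := by exact_mod_cast Nat.lt_succ_iff.1 (by exact_mod_cast hq)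
    push_cast at hq'
    nlinarith [h.eps_le_one]

theorem mul_le_of_getElem?_eq (h : IsBlockCode n L ε V) (hu : u ∈ V) (hv : v ∈ V) (huv : u ≠ v)
    (hi : i + q ≤ L) (he : ∀ t < q, u[i + t]? = v[i + t]?) : ((n : ℝ) - 1) * (q + ε) ≤ L :=
  h.mul_le_of_admissible (by omega)
    (h.admissible_of_common_factor hu hv huv (by have := h.pos; omega) hi hi he)

theorem mul_le_of_prefix (h : IsBlockCode n L ε V) (hu : u ∈ V) (hv : v ∈ V) (huv : u ≠ v)
    (hxu : x <+: u) (hxv : x <+: v) : ((n : ℝ) - 1) * (x.length + ε) ≤ L := by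
  refine h.mul_le_of_getElem?_eq hu hv huv (i := 0)
    (by rw [zero_add, ← h.length_eq u hu]; exact hxu.length_le) fun t ht => ?_
  rw [zero_add, List.prefix_iff_getElem?.1 hxu t ht, List.prefix_iff_getElem?.1 hxv t ht]

theorem mul_le_of_suffix (h : IsBlockCode n L ε V) (hu : u ∈ V) (hv : v ∈ V) (huv : u ≠ v)
    (hxu : x <:+ u) (hxv : x <:+ v) : ((n : ℝ) - 1) * (x.length + ε) ≤ L := by
  have hle : x.length ≤ L := h.length_eq u hu ▸ hxu.length_le
  refine h.mul_le_of_getElem?_eq hu hv huv (i := L - x.length) (by omega) fun t ht => ?_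
  have hxu' := (List.suffix_iff_getElem?.1 hxu).2 t ht
  have hxv' := (List.suffix_iff_getElem?.1 hxv).2 t ht
  rw [h.length_eq u hu] at hxu'
  rw [h.length_eq v hv] at hxv'
  rw [show L - x.length + t = t + L - x.length by omega, hxu', hxv']

theorem no_overlap (h : IsBlockCode n L ε V) (hx : x ∈ V) (hy : y ∈ V) (hq : 0 < q) (hqL : q < L)
    (he : ∀ t < q, x[L - q + t]? = y[t]?) : False := by
  have hlen := h.length_eq x hx
  by_cases hxy : x = y
  · subst hxy
    have hper : per x ≤ L - q := per_le (by omega) (List.hasPeriod_iff_getElem?.2 fun t ht => by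
      rw [← he t (by omega), add_comm])
    have := h.per_eq x hx
    omega
  · have hbound := (h.admissible_of_common_factor hx hy hxy (i := L - q) (j := 0) (q := q)
      (by omega) (by omega) (by omega) fun t ht => by rw [he t ht, zero_add]).1
    rw [show L + 0 - (L - q) = q by omega] at hbound
    have hq' : (0 : ℝ) < q := by exact_mod_cast hq
    nlinarith [h.two_le_sub_one]

/-- If the later copy of the repeated factor runs over from `x` into `z`, its part in `x` is a
repetition in `x ++ y`, its part in `z` is one in `y ++ z`, and the two periods add up to `L`. -/
theorem mul_le_of_shifted (h : IsBlockCode n L ε V) (hx : x ∈ V) (hy : y ∈ V) (hz : z ∈ V)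
    (hxz : x ≠ z) (hji : j < i) (hi : i < L) (hjq : j + q ≤ L)
    (he : ∀ t < q, (x ++ z)[i + t]? = y[j + t]?) : ((n : ℝ) - 1) * (q + ε) ≤ L := by
  have he_left : ∀ t < q, i + t < L → x[i + t]? = y[j + t]? := fun t ht hit => by
    rw [← he t ht, h.getElem?_append_of_lt hx hit]
  rcases eq_or_ne y x with rfl | hyx
  · refine h.mul_le_of_admissible (d := i - j) (by omega)
      (h.admissible_of_isRepetition hy hz hxz (i := j) (by omega)
      ⟨by rw [h.length_append hy hz]; omega, fun t ht => ?_⟩)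
    rw [show j + (i - j) + t = i + t by omega, he t ht, h.getElem?_append_of_lt hy (by omega)]
  rcases eq_or_ne y z with rfl | hyz
  · refine h.mul_le_of_admissible (d := L + j - i) (by omega)
      (h.admissible_of_isRepetition hx hy hxz (i := i) (by omega)
      ⟨by rw [h.length_append hx hy]; omega, fun t ht => ?_⟩)
    rw [show i + (L + j - i) + t = L + (j + t) by omega, he t ht, h.getElem?_append_add hx]
  rcases le_total (i + q) L with hiq | hiq
  · exact h.mul_le_of_admissible (d := L + j - i) (by omega)
      (h.admissible_of_common_factor hx hy hyx.symm (by omega) hiq hjq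
        fun t ht => he_left t ht (by omega))
  obtain ⟨r, rfl⟩ : ∃ r, q = L - i + r := ⟨q - (L - i), by omega⟩
  have hleft : Admissible n ε (L + j - i) (L - i) :=
    h.admissible_of_common_factor hx hy hyx.symm (by omega) (by omega) (by omega)
      fun t ht => he_left t (by omega) (by omega)
  have hright : Admissible n ε (L + 0 - (j + (L - i))) r :=
    h.admissible_of_common_factor hy hz hyz (by omega) (by omega) (by omega) fun t ht => by
      rw [add_assoc, ← he _ (by omega), show i + (L - i + t) = L + t by omega,
        h.getElem?_append_add hx, zero_add]
  have hsum : ((L + j - i : ℕ) : ℝ) + ((L + 0 - (j + (L - i)) : ℕ) : ℝ) = L := by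
    rw [← Nat.cast_add]; congr 1; omega
  push_cast
  rcases h.eps_eq_zero_or with rfl | hL
  · linarith [hleft.1, hright.1]
  rcases (by omega : 3 * (n - 1) ≤ L + j - i ∨ 3 * (n - 1) ≤ L + 0 - (j + (L - i))) with h3 | h3
  · linarith [hleft.2 h3, hright.1]
  · linarith [hright.2 h3, hleft.1]

end IsBlockCode

section InitialWord

variable {α : Type*} {a : ℕ → α} {m i : ℕ}

theorem length_initialWord (a : ℕ → α) (m : ℕ) : (initialWord a m).length = m := by
  rw [initialWord, List.length_map, List.length_range]

theorem initialWord_succ (a : ℕ → α) (m : ℕ) :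
    initialWord a (m + 1) = initialWord a m ++ [a m] := by
  rw [initialWord, List.range_succ, List.map_append, List.map_singleton, initialWord]

theorem getElem?_initialWord (hi : i < m) : (initialWord a m)[i]? = some (a i) := by
  rw [initialWord, List.getElem?_map, List.getElem?_range hi, Option.map_some]

theorem exists_eq_initialWord [Nonempty α] (w : List α) : ∃ a, w = initialWord a w.length := by
  refine ⟨fun i => w[i]?.getD (Classical.arbitrary α), List.ext_getElem? fun i => ?_⟩
  rcases Nat.lt_or_ge i w.length with h | h
  · rw [getElem?_initialWord h, List.getElem?_eq_getElem h, Option.getD_some]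
  · rw [List.getElem?_eq_none h, List.getElem?_eq_none (by rwa [length_initialWord])]

end InitialWord

section BlockLetters

variable {β : Type*} {L : ℕ} {B : ℕ → List β} {u v : List β} {j m c r : ℕ}

/-- The letter at position `j` of the infinite product `B 0 ++ B 1 ++ ⋯` of words of length `L`. -/
def blockLetter (L : ℕ) (B : ℕ → List β) (j : ℕ) : Option β :=
  (B (j / L))[j % L]?

theorem blockLetter_mul_add (hr : r < L) : blockLetter L B (c * L + r) = (B c)[r]? := by
  rw [blockLetter, Nat.mul_add_mod_of_lt hr, mul_comm, Nat.mul_add_div (by omega),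
    Nat.div_eq_of_lt hr, add_zero]

theorem blockLetter_mul_add_add :
    blockLetter L B (c * L + (L + j)) = blockLetter L B ((c + 1) * L + j) := by
  rw [Nat.succ_mul, add_assoc]

theorem length_flatten_initialWord (hB : ∀ c, (B c).length = L) (m : ℕ) :
    (initialWord B m).flatten.length = m * L := by
  induction m with
  | zero => rw [zero_mul]; rfl
  | succ m ih =>
    rw [initialWord_succ, List.flatten_append, List.length_append, ih, List.flatten_singleton,
      hB, Nat.succ_mul]

theorem getElem?_flatten_initialWord (hB : ∀ c, (B c).length = L) (hj : j < m * L) :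
    (initialWord B m).flatten[j]? = blockLetter L B j := by
  induction m with
  | zero => omega
  | succ m ih =>
    rw [Nat.succ_mul] at hj
    have hlen := length_flatten_initialWord hB m
    rw [initialWord_succ, List.flatten_append, List.flatten_singleton]
    rcases Nat.lt_or_ge j (m * L) with hjm | hjm
    · rw [List.getElem?_append_left (by omega), ih hjm]
    · obtain ⟨r, rfl⟩ := Nat.exists_eq_add_of_le hjm
      rw [List.getElem?_append_right (by omega), hlen, Nat.add_sub_cancel_left,
        blockLetter_mul_add (by omega)]

theorem take_eq_take_of_getElem? (h : ∀ t < r, u[t]? = v[t]?) : u.take r = v.take r := by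
  refine List.ext_getElem? fun t => ?_
  rw [List.getElem?_take, List.getElem?_take]
  split_ifs with ht
  exacts [h t ht, rfl]

theorem drop_eq_drop_of_getElem? (h : ∀ t, r ≤ t → u[t]? = v[t]?) : u.drop r = v.drop r := by
  refine List.ext_getElem? fun t => ?_
  rw [List.getElem?_drop, List.getElem?_drop, h _ (by omega)]

end BlockLetters

namespace IsBlockCode

variable {n L m a c i i₀ j₀ p q : ℕ} {ε : ℝ} {V : Finset (List (Fin n))}
  {B : ℕ → List (Fin n)}

theorem exists_append (h : IsBlockCode n L ε V) (hB : ∀ c, B c ∈ V)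
    (hne : ∀ c, c + 1 < m → B c ≠ B (c + 1)) (c : ℕ) :
    ∃ z ∈ V, B c ≠ z ∧
      ∀ t < 2 * L, c * L + t < m * L → blockLetter L B (c * L + t) = (B c ++ z)[t]? := by
  have hfirst : ∀ z, ∀ t < L, blockLetter L B (c * L + t) = (B c ++ z)[t]? := fun z t ht => by
    rw [blockLetter_mul_add ht, h.getElem?_append_of_lt (hB c) ht]
  by_cases hm : c + 1 < m
  · refine ⟨B (c + 1), hB _, hne c hm, fun t ht _ => ?_⟩
    rcases Nat.lt_or_ge t L with htL | htL
    · exact hfirst _ t htL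
    · obtain ⟨r, rfl⟩ := Nat.exists_eq_add_of_le htL
      rw [blockLetter_mul_add_add, blockLetter_mul_add (by omega), h.getElem?_append_add (hB c)]
  · obtain ⟨z, hz, hzc⟩ := h.nontrivial.exists_ne (B c)
    refine ⟨z, hz, hzc.symm, fun t _ htm => hfirst z t ?_⟩
    have hmc := Nat.mul_le_mul_right L (not_lt.1 hm)
    rw [Nat.succ_mul] at hmc
    omega

theorem add_le_of_offset_lt (h : IsBlockCode n L ε V) (hB : ∀ c, B c ∈ V) (hij : j₀ < i₀)
    (hi : i₀ < L)
    (he : ∀ t < q, blockLetter L B (a * L + (i₀ + t)) = blockLetter L B (c * L + (j₀ + t))) :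
    j₀ + q ≤ L := by
  by_contra! hlt
  refine h.no_overlap (hB c) (hB (a + 1)) (q := i₀ - j₀) (by omega) (by omega) fun t ht => ?_
  have hshift := he (L - i₀ + t) (by omega)
  rw [show i₀ + (L - i₀ + t) = L + t by omega, blockLetter_mul_add_add,
    blockLetter_mul_add (by omega), blockLetter_mul_add (by omega)] at hshift
  rw [hshift]
  congr 1; omega

theorem mul_le_of_offset_lt (h : IsBlockCode n L ε V) (hB : ∀ c, B c ∈ V)
    (hne : ∀ c, c + 1 < m → B c ≠ B (c + 1)) (hij : j₀ < i₀) (hi : i₀ < L)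
    (hm : a * L + (i₀ + q) ≤ m * L)
    (he : ∀ t < q, blockLetter L B (a * L + (i₀ + t)) = blockLetter L B (c * L + (j₀ + t))) :
    ((n : ℝ) - 1) * (q + ε) ≤ L := by
  have hq := h.add_le_of_offset_lt hB hij hi he
  obtain ⟨z, hz, haz, hget⟩ := h.exists_append hB hne a
  refine h.mul_le_of_shifted (hB a) (hB c) hz haz hij hi hq fun t ht => ?_
  rw [← hget _ (by omega) (by omega), he t ht, blockLetter_mul_add (by omega)]

/-- The two offsets within a block differ, so the repeated part stays within a block on one side
and is a factor of a block occurring at another offset in a product of two blocks. -/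
theorem admissible_of_not_dvd (h : IsBlockCode n L ε V) (hB : ∀ c, B c ∈ V)
    (hne : ∀ c, c + 1 < m → B c ≠ B (c + 1)) (hm : i + p + q ≤ m * L)
    (he : ∀ t < q, blockLetter L B (i + t) = blockLetter L B (i + p + t)) (hp : ¬ L ∣ p) :
    Admissible n ε p q := by
  have hL := h.pos
  obtain ⟨a, i₀, hi₀, rfl⟩ : ∃ a i₀, i₀ < L ∧ i = a * L + i₀ :=
    ⟨i / L, i % L, Nat.mod_lt _ hL, (Nat.div_add_mod' i L).symm⟩
  obtain ⟨c, j₀, hj₀, hj⟩ : ∃ c j₀, j₀ < L ∧ a * L + i₀ + p = c * L + j₀ :=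
    ⟨(a * L + i₀ + p) / L, (a * L + i₀ + p) % L, Nat.mod_lt _ hL, (Nat.div_add_mod' _ L).symm⟩
  have hij : i₀ ≠ j₀ := by
    rintro rfl
    exact hp ((Nat.dvd_add_right (Dvd.intro_left a rfl)).1
      ((by omega : a * L + p = c * L) ▸ Dvd.intro_left c rfl))
  have he' : ∀ t < q, blockLetter L B (a * L + (i₀ + t)) = blockLetter L B (c * L + (j₀ + t)) :=
    fun t ht => by rw [← add_assoc, he t ht, hj, add_assoc]
  have hbound : ((n : ℝ) - 1) * (q + ε) ≤ L := by
    rcases hij.lt_or_gt with hlt | hlt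
    · exact h.mul_le_of_offset_lt hB hne hlt hj₀ (by omega) fun t ht => (he' t ht).symm
    · exact h.mul_le_of_offset_lt hB hne hlt hi₀ (by omega) he'
  rcases Nat.lt_or_ge p L with hpL | hpL
  · have hend : i₀ + p + q ≤ 2 * L := by
      rcases hij.lt_or_gt with hlt | hlt
      · have := h.add_le_of_offset_lt hB hlt hj₀ fun t ht => (he' t ht).symm
        omega
      · have hq := h.add_le_of_offset_lt hB hlt hi₀ he'
        have hca : c < a + 2 := Nat.lt_of_mul_lt_mul_right (a := L) (by rw [Nat.add_mul]; omega)
        have := Nat.mul_le_mul_right L (Nat.le_of_lt_succ hca)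
        rw [Nat.succ_mul] at this
        omega
    obtain ⟨z, hz, haz, hget⟩ := h.exists_append hB hne a
    refine h.admissible_of_isRepetition (hB a) hz haz (i := i₀)
      (Nat.pos_of_ne_zero (by rintro rfl; exact hp (dvd_zero L)))
      ⟨by rwa [h.length_append (hB a) hz], fun t ht => ?_⟩
    rw [← hget _ (by omega) (by omega), ← hget _ (by omega) (by omega), ← add_assoc, he t ht,
      ← add_assoc, ← add_assoc]
  · have hpL' : (L : ℝ) ≤ p := by exact_mod_cast hpL
    exact ⟨by nlinarith [h.two_le_sub_one, h.eps_nonneg], fun _ => hbound.trans hpL'⟩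

end IsBlockCode

section ShiftedRuns

variable {β : Type*} {L m k b c d e f i q r : ℕ} {B : ℕ → List β} {u v x y : List β}

/-- The blocks `b, …, b + d - 1` equal the blocks `k` places further to the right, and this
equality extends by a common suffix `x` to the left and by a common prefix `y` to the right, each
of them empty or taken from two different blocks. Only the first `m` blocks are considered. -/
structure IsShiftedRun (m k : ℕ) (B : ℕ → List β) (b d : ℕ) (x y : List β) : Prop where
  add_le : b + d + k ≤ m
  eq : ∀ c, b ≤ c → c < b + d → B c = B (c + k)
  suff : x = [] ∨ ∃ c, b = c + 1 ∧ B c ≠ B (c + k) ∧ x <:+ B c ∧ x <:+ B (c + k)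
  pref : y = [] ∨ b + d + k < m ∧ B (b + d) ≠ B (b + d + k) ∧ y <+: B (b + d) ∧
    y <+: B (b + d + k)

theorem exists_common_prefix (hu : r ≤ u.length) (h : ∀ t < r, u[t]? = v[t]?) :
    ∃ y, y <+: u ∧ y <+: v ∧ y.length = r :=
  ⟨u.take r, List.take_prefix _ _, take_eq_take_of_getElem? h ▸ List.take_prefix _ _,
    List.length_take_of_le hu⟩

theorem exists_common_suffix (hu : u.length = L) (hv : v.length = L)
    (h : ∀ t, i ≤ t → t < L → u[t]? = v[t]?) : ∃ x, x <:+ u ∧ x <:+ v ∧ x.length = L - i := by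
  have hdrop : u.drop i = v.drop i := drop_eq_drop_of_getElem? fun t hit => by
    rcases Nat.lt_or_ge t L with ht | ht
    · exact h t hit ht
    · rw [List.getElem?_eq_none (by omega), List.getElem?_eq_none (by omega)]
  exact ⟨u.drop i, List.drop_suffix _ _, hdrop ▸ List.drop_suffix _ _, by rw [List.length_drop, hu]⟩

theorem eq_of_getElem?_eq_of_lt (hu : u.length = L) (hv : v.length = L)
    (h : ∀ t < L, u[t]? = v[t]?) : u = v := by
  obtain ⟨y, hy, hy', hlen⟩ := exists_common_prefix hu.ge h
  rw [← hy.eq_of_length (hlen.trans hu.symm), ← hy'.eq_of_length (hlen.trans hv.symm)]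

theorem getElem?_eq_of_blockLetter_eq
    (he : ∀ t < q, blockLetter L B (i + t) = blockLetter L B (i + k * L + t)) (hr : r < L)
    (hi : i ≤ c * L + r) (hq : c * L + r < i + q) : (B c)[r]? = (B (c + k))[r]? := by
  have hshift := he (c * L + r - i) (by omega)
  rwa [show i + (c * L + r - i) = c * L + r by omega,
    show i + k * L + (c * L + r - i) = (c + k) * L + r by rw [Nat.add_mul]; omega,
    blockLetter_mul_add hr, blockLetter_mul_add hr] at hshift

theorem exists_run_start (hB : ∀ c, (B c).length = L)
    (h : ∀ t, i ≤ t → t < L → (B e)[t]? = (B (e + k))[t]?) :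
    ∃ b x, e ≤ b ∧ b ≤ e + 1 ∧ b * L ≤ e * L + i + x.length ∧ (b = e → B e = B (e + k)) ∧
      (x = [] ∨ ∃ c, b = c + 1 ∧ B c ≠ B (c + k) ∧ x <:+ B c ∧ x <:+ B (c + k)) := by
  by_cases he : B e = B (e + k)
  · exact ⟨e, [], le_rfl, by omega, by omega, fun _ => he, Or.inl rfl⟩
  · obtain ⟨x, hx, hx', hlen⟩ := exists_common_suffix (hB e) (hB (e + k)) h
    exact ⟨e + 1, x, by omega, le_rfl, by rw [Nat.succ_mul]; omega, fun hb => by omega,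
      Or.inr ⟨e, rfl, he, hx, hx'⟩⟩

theorem exists_run_end (hB : ∀ c, (B c).length = L) (hr : r ≤ L) (hf : f + k < m)
    (h : ∀ t < r, (B f)[t]? = (B (f + k))[t]?) :
    ∃ g y, f ≤ g ∧ g ≤ f + 1 ∧ g + k ≤ m ∧ f * L + r ≤ g * L + y.length ∧
      (f < g → B f = B (f + k)) ∧
      (y = [] ∨ g + k < m ∧ B g ≠ B (g + k) ∧ y <+: B g ∧ y <+: B (g + k)) := by
  by_cases hf' : B f = B (f + k)
  · exact ⟨f + 1, [], by omega, le_rfl, by omega, by rw [Nat.succ_mul]; omega, fun _ => hf',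
      Or.inl rfl⟩
  · obtain ⟨y, hy, hy', hlen⟩ := exists_common_prefix (hr.trans_eq (hB f).symm) h
    exact ⟨f, y, le_rfl, by omega, hf.le, by omega, fun hff => by omega,
      Or.inr ⟨hf, hf', hy, hy'⟩⟩

end ShiftedRuns

namespace IsBlockCode

variable {n L m k b d i q : ℕ} {ε : ℝ} {V : Finset (List (Fin n))} {B : ℕ → List (Fin n)}
  {x y : List (Fin n)}

theorem exists_shiftedRun (h : IsBlockCode n L ε V) (hB : ∀ c, B c ∈ V) (hq : 0 < q)
    (hm : i + k * L + q ≤ m * L)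
    (he : ∀ t < q, blockLetter L B (i + t) = blockLetter L B (i + k * L + t)) :
    ((n : ℝ) - 1) * (q + ε) ≤ L ∨
      ∃ b d x y, IsShiftedRun m k B b d x y ∧ q ≤ x.length + d * L + y.length := by
  have hL := h.pos
  have hlen : ∀ c, (B c).length = L := fun c => h.length_eq _ (hB c)
  have hfull : ∀ c, i ≤ c * L → c * L + L ≤ i + q → B c = B (c + k) := fun c hi hq =>
    eq_of_getElem?_eq_of_lt (hlen c) (hlen _) fun t ht =>
      getElem?_eq_of_blockLetter_eq (c := c) he ht (by omega) (by omega)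
  obtain ⟨e, i₀, hi₀, rfl⟩ : ∃ e i₀, i₀ < L ∧ i = e * L + i₀ :=
    ⟨i / L, i % L, Nat.mod_lt _ hL, (Nat.div_add_mod' i L).symm⟩
  obtain ⟨f, r, hr, hf⟩ : ∃ f r, r < L ∧ e * L + i₀ + q = f * L + (r + 1) :=
    ⟨(e * L + i₀ + q - 1) / L, (e * L + i₀ + q - 1) % L, Nat.mod_lt _ hL, by
      rw [← add_assoc, Nat.div_add_mod']; omega⟩
  have hfm : f + k < m := Nat.lt_of_mul_lt_mul_right (a := L) (by rw [Nat.add_mul]; omega)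
  have hef : e < f + 1 := Nat.lt_of_mul_lt_mul_right (a := L) (by rw [Nat.succ_mul]; omega)
  rcases Nat.lt_succ_iff_lt_or_eq.1 hef with hef | rfl
  · have hef' := Nat.mul_le_mul_right L hef
    rw [Nat.succ_mul] at hef'
    obtain ⟨b, x, heb, hbe, hbx, hb, hsuff⟩ := exists_run_start (k := k) hlen (i := i₀)
      fun t ht htL => getElem?_eq_of_blockLetter_eq (c := e) he htL (by omega) (by omega)
    obtain ⟨g, y, hfg, hgf, hgm, hgy, hg, hpref⟩ := exists_run_end hlen hr hfm
      fun t ht => getElem?_eq_of_blockLetter_eq (c := f) he (by omega) (by omega) (by omega)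
    obtain ⟨d, rfl⟩ := Nat.exists_eq_add_of_le (show b ≤ g by omega)
    refine Or.inr ⟨b, d, x, y, ⟨hgm, fun c hbc hcd => ?_, hsuff, hpref⟩, ?_⟩
    · rcases (by omega : c = e ∨ c = f ∨ e < c ∧ c < f) with rfl | rfl | ⟨hec, hcf⟩
      · exact hb (by omega)
      · exact hg (by omega)
      · have hec' := Nat.mul_le_mul_right L hec
        have hcf' := Nat.mul_le_mul_right L hcf
        rw [Nat.succ_mul] at hec' hcf'
        exact hfull c (by omega) (by omega)
    · rw [Nat.add_mul] at hgy
      omega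
  · by_cases hBe : B e = B (e + k)
    · refine Or.inr ⟨e, 1, [], [], ⟨by omega, fun c hec hce => ?_, Or.inl rfl, Or.inl rfl⟩, ?_⟩
      · obtain rfl : c = e := by omega
        exact hBe
      · rw [one_mul]; simp only [List.length_nil]; omega
    · exact Or.inl (h.mul_le_of_getElem?_eq (hB e) (hB _) hBe (i := i₀) (by omega)
        fun t ht => getElem?_eq_of_blockLetter_eq (c := e) he (by omega) (by omega) (by omega))

theorem mul_le_of_shiftedRun_left (h : IsBlockCode n L ε V) (hB : ∀ c, B c ∈ V)
    (hr : IsShiftedRun m k B b d x y) : ((n : ℝ) - 1) * (x.length + ε) ≤ L := by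
  rcases hr.suff with rfl | ⟨c, -, hne, hx, hx'⟩
  · simpa using h.mul_eps_le
  · exact h.mul_le_of_suffix (hB _) (hB _) hne hx hx'

theorem mul_le_of_shiftedRun_right (h : IsBlockCode n L ε V) (hB : ∀ c, B c ∈ V)
    (hr : IsShiftedRun m k B b d x y) : ((n : ℝ) - 1) * (y.length + ε) ≤ L := by
  rcases hr.pref with rfl | ⟨-, hne, hy, hy'⟩
  · simpa using h.mul_eps_le
  · exact h.mul_le_of_prefix (hB _) (hB _) hne hy hy'

end IsBlockCode

section Criterion

variable {α : Type*} {n L m k b : ℕ} {ε : ℝ} {V : Finset (List (Fin n))}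
  {J : α → Set (List (Fin n))} {a : ℕ → α} {B : ℕ → List (Fin n)} {x y : List (Fin n)}

theorem OverlapCondition.mul_le (hO : OverlapCondition n L ε V J) (hn : 2 ≤ n)
    (hJ : ∀ ⦃a b x⦄, x ∈ J a → x ∈ J b → a = b) {a b c : α} (hba : b ≠ a) (hca : c ≠ a)
    (hbc : b ≠ c) {u w z z' p s : List (Fin n)} (hu : u ∈ V) (hub : u ∈ J b) (hw : w ∈ V)
    (hwc : w ∈ J c) (hz : z ∈ J a) (hz' : z' ∈ J a) (hpu : p <+: u) (hpz : p <+: z)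
    (hsz : s <:+ z') (hsw : s <:+ w) : ((n : ℝ) - 1) * (s.length + p.length + ε) ≤ L := by
  have hn' : (2 : ℝ) ≤ n := by exact_mod_cast hn
  have hbound := hO a u hu (fun hua => hba (hJ hub hua)) w hw (fun hwa => hca (hJ hwc hwa))
    (fun huw => hbc (hJ hub (huw ▸ hwc))) z hz z' hz' p s hpu hpz hsz hsw
  rw [le_div_iff₀ (by linarith)] at hbound
  linarith

theorem IsBlockCode.mul_le_of_shiftedRun_zero (h : IsBlockCode n L ε V)
    (hJ : ∀ ⦃a b x⦄, x ∈ J a → x ∈ J b → a = b) (hO : OverlapCondition n L ε V J)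
    (ha : ∀ i j, i < j → j ≤ i + 2 → j < m → a i ≠ a j) (hB : ∀ c, B c ∈ V)
    (hBJ : ∀ c, B c ∈ J (a c)) (hk : 0 < k) (hr : IsShiftedRun m k B b 0 x y) :
    ((n : ℝ) - 1) * (x.length + y.length + ε) ≤ (k * L : ℕ) := by
  have htwo := h.two_le_sub_one
  have hε := h.eps_nonneg
  have hleft := h.mul_le_of_shiftedRun_left hB hr
  have hright := h.mul_le_of_shiftedRun_right hB hr
  rcases Nat.lt_or_ge 1 k with hk2 | hk1
  · have hkL : ((2 * L : ℕ) : ℝ) ≤ (k * L : ℕ) := by exact_mod_cast Nat.mul_le_mul_right L hk2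
    rw [Nat.cast_mul, Nat.cast_ofNat] at hkL
    nlinarith
  obtain rfl : k = 1 := by omega
  rw [one_mul]
  rcases hr.suff with rfl | ⟨c, rfl, -, hx, hx'⟩
  · simpa using hright
  rcases hr.pref with rfl | ⟨hm, -, hy, hy'⟩
  · simpa using hleft
  exact hO.mul_le (by have := h.three_le; omega) hJ
    (ha (c + 1) (c + 1 + 0 + 1) (by omega) (by omega) hm).symm
    (ha c (c + 1) (by omega) (by omega) (by omega))
    (ha c (c + 1 + 0 + 1) (by omega) (by omega) hm).symm (hB _) (hBJ _) (hB _) (hBJ _)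
    (hBJ _) (hBJ _) hy' hy hx' hx

theorem IsBlockCode.flatten_mem_epsThreshold (h : IsBlockCode n L ε V)
    (hJ : ∀ ⦃a b x⦄, x ∈ J a → x ∈ J b → a = b) (hO : OverlapCondition n L ε V J)
    (ha : ∀ i j, i < j → j ≤ i + 2 → j < m → a i ≠ a j) (hB : ∀ c, B c ∈ V)
    (hBJ : ∀ c, B c ∈ J (a c))
    (hlong : ∀ k b d x y, 0 < k → 0 < d → IsShiftedRun m k B b d x y →
      ((n : ℝ) - 1) * ((x.length + d * L + y.length : ℕ) + ε) ≤ (k * L : ℕ)) :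
    (initialWord B m).flatten ∈ epsThreshold n ε := by
  have htwo := h.two_le_sub_one
  have hlen : ∀ c, (B c).length = L := fun c => h.length_eq _ (hB c)
  rw [mem_epsThreshold_iff h.three_le h.eps_le_one]
  intro i p q hp hr
  obtain ⟨hm, he⟩ := hr
  rw [length_flatten_initialWord hlen] at hm
  have he' : ∀ t < q, blockLetter L B (i + t) = blockLetter L B (i + p + t) := fun t ht => by
    rw [← getElem?_flatten_initialWord (m := m) hlen (by omega), he t ht,
      getElem?_flatten_initialWord hlen (by omega)]
  by_cases hpL : L ∣ p
  · obtain ⟨k, rfl⟩ := hpL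
    rw [mul_comm L k] at *
    have hk : 0 < k := Nat.pos_of_ne_zero (by rintro rfl; omega)
    have hLk : (L : ℝ) ≤ (k * L : ℕ) := by exact_mod_cast Nat.le_mul_of_pos_left L hk
    suffices hbound : ((n : ℝ) - 1) * (q + ε) ≤ (k * L : ℕ) from
      ⟨by nlinarith [h.eps_nonneg], fun _ => hbound⟩
    rcases Nat.eq_zero_or_pos q with rfl | hq
    · rw [Nat.cast_zero, zero_add]
      exact h.mul_eps_le.trans hLk
    rcases h.exists_shiftedRun hB hq hm he' with hbound | ⟨b, d, x, y, hrun, hqle⟩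
    · exact hbound.trans hLk
    have hqle' : (q : ℝ) ≤ (x.length + d * L + y.length : ℕ) := by exact_mod_cast hqle
    rcases Nat.eq_zero_or_pos d with rfl | hd
    · have := h.mul_le_of_shiftedRun_zero hJ hO ha hB hBJ hk hrun
      rw [zero_mul, add_zero, Nat.cast_add] at hqle'
      nlinarith
    · nlinarith [hlong k b d x y hk hd hrun]
  · refine h.admissible_of_not_dvd hB (fun c hc hne => ?_) hm he' hpL
    exact ha c (c + 1) (by omega) (by omega) hc (hJ (hBJ c) (hne ▸ hBJ (c + 1)))

end Criterion

section Occurrences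

variable {P : ℕ → Prop} [DecidablePred P] {g H r k c d i j m : ℕ}

theorem exists_count_eq (h : d < Nat.count P j) : ∃ t < j, P t ∧ Nat.count P t = d := by
  induction j with
  | zero => simp only [Nat.count_zero, not_lt_zero] at h
  | succ j ih =>
    rcases Nat.lt_or_ge d (Nat.count P j) with hd | hd
    · obtain ⟨t, ht, hP⟩ := ih hd
      exact ⟨t, by omega, hP⟩
    · rw [Nat.count_succ] at h
      split_ifs at h with hP
      · exact ⟨j, by omega, hP, by omega⟩
      · omega

theorem le_of_count_le (hj : P j) (h : Nat.count P i ≤ Nat.count P j) : i ≤ j := by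
  by_contra! hji
  exact absurd (Nat.count_strict_mono hj hji) (by omega)

theorem add_mul_le_of_count_add_le (hg : ∀ i j, i < j → j < m → P i → P j → i + g ≤ j)
    (hj : P j) (hm : j < m) (hr : Nat.count P i + r ≤ Nat.count P j) :
    i + r * g ≤ j := by
  induction r generalizing j with
  | zero => rw [zero_mul]; exact le_of_count_le hj hr
  | succ r ih =>
    obtain ⟨t, htj, ht, hcount⟩ := exists_count_eq (P := P) (d := Nat.count P i + r) (j := j)
      (by omega)
    have hit := ih ht (by omega) hcount.ge
    have hgap := hg t j htj hm ht hj
    rw [Nat.succ_mul]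
    omega

theorem add_mul_le_of_count_modEq (hg : ∀ i j, i < j → j < m → P i → P j → i + g ≤ j)
    (hij : i < j) (hm : j < m) (hi : P i) (hj : P j)
    (hk : Nat.count P i ≡ Nat.count P j [MOD k]) : i + k * g ≤ j :=
  add_mul_le_of_count_add_le hg hj hm (hk.add_le_of_lt (Nat.count_strict_mono hi hij))

theorem count_add_le_count (hH : ∀ i, ∃ t, i ≤ t ∧ t < i + H ∧ P t) (c r : ℕ) :
    Nat.count P c + r ≤ Nat.count P (c + r * H) := by
  induction r with
  | zero => rw [zero_mul]; rfl
  | succ r ih =>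
    obtain ⟨t, hct, htH, ht⟩ := hH (c + r * H)
    have hle := Nat.count_monotone P hct
    have hlt := Nat.count_strict_mono ht htH
    rw [Nat.succ_mul, ← add_assoc c]
    omega

theorem exists_count_modEq (hH : ∀ i, ∃ t, i ≤ t ∧ t < i + H ∧ P t) (hk : 0 < k) (c s : ℕ) :
    ∃ t, c ≤ t ∧ t < c + k * H ∧ P t ∧ Nat.count P t ≡ s [MOD k] := by
  obtain ⟨d, hd, hdk, hmod⟩ : ∃ d, Nat.count P c ≤ d ∧ d < Nat.count P c + k ∧ d ≡ s [MOD k] := by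
    refine ⟨Nat.count P c + (s + Nat.count P c * (k - 1)) % k, Nat.le_add_right _ _,
      Nat.add_lt_add_left (Nat.mod_lt _ hk) _, ?_⟩
    obtain ⟨k, rfl⟩ := Nat.exists_eq_succ_of_ne_zero hk.ne'
    rw [Nat.ModEq, Nat.add_mod_mod, Nat.succ_sub_one,
      show Nat.count P c + (s + Nat.count P c * k) = Nat.count P c * k.succ + s by
        rw [Nat.mul_succ]; ring,
      Nat.mul_add_mod_self_right]
  obtain ⟨t, htk, ht, rfl⟩ := exists_count_eq (hdk.trans_le (count_add_le_count hH c k))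
  exact ⟨t, le_of_count_le ht hd, htk, ht, hmod⟩

end Occurrences

section Letters

variable {M m k c i j p q : ℕ} {a : ℕ → Fin M}

theorem count_initialWord {α : Type*} [DecidableEq α] (a : ℕ → α) (x : α) (c : ℕ) :
    (initialWord a c).count x = Nat.count (a · = x) c := by
  induction c with
  | zero => rfl
  | succ c ih =>
    simp only [initialWord_succ, List.count_append, List.count_singleton, Nat.count_succ, ih,
      beq_iff_eq]

theorem mul_le_of_letters_eq (hM : 2 ≤ M) (ha : initialWord a m ∈ threshold M) (hp : 0 < p)
    (hm : i + p + q ≤ m) (he : ∀ t < q, a (i + t) = a (i + p + t)) : (M - 1) * q ≤ p := by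
  have hbound := (mem_threshold_iff hM).1 ha i p q hp
    ⟨by rwa [length_initialWord], fun t ht => by
      rw [getElem?_initialWord (by omega), getElem?_initialWord (by omega), he t ht]⟩
  rw [← Nat.cast_le (α := ℝ), Nat.cast_mul, Nat.cast_sub (by omega), Nat.cast_one]
  exact hbound

theorem add_le_of_letter_eq (hM : 2 ≤ M) (ha : initialWord a m ∈ threshold M) (hij : i < j)
    (hj : j < m) (he : a i = a j) : i + (M - 1) ≤ j := by
  obtain ⟨p, rfl⟩ := Nat.exists_eq_add_of_le hij.le
  have := mul_le_of_letters_eq hM ha (i := i) (p := p) (q := 1) (by omega) (by omega)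
    fun t ht => by obtain rfl : t = 0 := by omega
                   exact he
  omega

theorem add_mul_le_of_letter_eq (hM : 2 ≤ M) (ha : initialWord a m ∈ threshold M) (hij : i < j)
    (hj : j < m) (he : a i = a j)
    (hk : Nat.count (a · = a i) i ≡ Nat.count (a · = a i) j [MOD k]) : i + k * (M - 1) ≤ j :=
  add_mul_le_of_count_modEq (P := (a · = a i))
    (fun _ _ hst ht hs ht' => add_le_of_letter_eq hM ha hst ht (hs.trans ht'.symm)) hij hj rfl
    he.symm hk

theorem letter_ne_of_letter_eq (hM : 2 ≤ M) (ha : initialWord a m ∈ threshold M)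
    (hm : c + M < m) (he : a c = a (c + (M - 1))) : a (c + 1) ≠ a (c + M) := fun he' => by
  have := mul_le_of_letters_eq hM ha (i := c) (p := M - 1) (q := 2) (by omega) (by omega)
    fun t ht => by
      rcases (by omega : t = 0 ∨ t = 1) with rfl | rfl
      · exact he
      · rw [he']; congr 1; omega
  omega

theorem exists_letter_eq_of_ne (hM : 2 ≤ M) (ha : initialWord a m ∈ threshold M) (hm : c + M ≤ m)
    (hne : a c ≠ a (c + (M - 1))) (x : Fin M) : ∃ t < M, a (c + t) = x := by
  have hinj : Function.Injective fun t : Fin M => a (c + t) := fun s t he => by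
    by_contra hst
    wlog hlt : s < t generalizing s t
    · exact this t s he.symm (Ne.symm hst) (by omega)
    have hgap := add_le_of_letter_eq hM ha (by omega) (by omega) he
    have hs : (s : ℕ) = 0 := by omega
    have ht : (t : ℕ) = M - 1 := by omega
    simp only [hs, ht] at he
    exact hne he
  obtain ⟨t, ht⟩ := Finite.injective_iff_surjective.1 hinj x
  exact ⟨t, t.isLt, ht⟩

theorem exists_letter_eq (hM : 2 ≤ M) (ha : initialWord a m ∈ threshold M)
    (hm : c + (M + 1) ≤ m) (x : Fin M) : ∃ t, c ≤ t ∧ t < c + (M + 1) ∧ a t = x := by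
  by_cases he : a c = a (c + (M - 1))
  · obtain ⟨t, ht, htx⟩ := exists_letter_eq_of_ne hM ha (c := c + 1) (by omega) (by
      rw [show c + 1 + (M - 1) = c + M by omega]
      exact letter_ne_of_letter_eq hM ha (by omega) he) x
    exact ⟨c + 1 + t, by omega, by omega, htx⟩
  · obtain ⟨t, ht, htx⟩ := exists_letter_eq_of_ne hM ha (by omega) he x
    exact ⟨c + t, by omega, by omega, htx⟩

theorem letter_ne_and_eq_of_return (hM : 4 ≤ M) (ha : initialWord a m ∈ threshold M)
    (hm : c + M + 1 < m) (he : a (c + 1) = a (c + M)) :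
    a c ≠ a (c + (M - 1)) ∧ a (c + M + 1) = a c := by
  have hne : a c ≠ a (c + (M - 1)) := fun hc =>
    letter_ne_of_letter_eq (by omega) ha (by omega) hc he
  have hne' : a (c + 1 + 1) ≠ a (c + 1 + M) :=
    letter_ne_of_letter_eq (by omega) ha (by omega)
      (by rw [show c + 1 + (M - 1) = c + M by omega, he])
  have hne'' : a (c + M) ≠ a (c + M + 1) := fun hc => by
    have := add_le_of_letter_eq (by omega) ha (Nat.lt_succ_self _) hm hc
    omega
  obtain ⟨t, ht, htx⟩ := exists_letter_eq_of_ne (by omega) ha (by omega) hne (a (c + M + 1))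
  have hgap := add_le_of_letter_eq (by omega) ha (i := c + t) (by omega) hm htx
  rcases (by omega : t = 0 ∨ t = 1 ∨ t = 2) with rfl | rfl | rfl
  · exact ⟨hne, htx.symm⟩
  · exact absurd (he.symm.trans htx) hne''
  · exact absurd (htx.trans (congrArg a (by omega))) hne'

end Letters

section Rules

variable {α β : Type*} {F : List α → α → List β} {v v' x : List β} {S : Set ℕ}

theorem substFrom_append (F : List α → α → List β) (u w z : List α) :
    substFrom F u (w ++ z) = substFrom F u w ++ substFrom F (u ++ w) z := by
  induction w generalizing u with
  | nil => rw [List.append_nil]; rfl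
  | cons a w ih =>
    simp only [List.cons_append, substFrom, ih, List.append_assoc, List.nil_append]

/-- The word which the rule `F` substitutes for the letter `a c` of the infinite word `a`. -/
def imageBlock (F : List α → α → List β) (a : ℕ → α) (c : ℕ) : List β :=
  F (initialWord a c) (a c)

theorem subst_initialWord (F : List α → α → List β) (a : ℕ → α) (m : ℕ) :
    subst F (initialWord a m) = (initialWord (imageBlock F a) m).flatten := by
  induction m with
  | zero => rfl
  | succ m ih =>
    rw [initialWord_succ, initialWord_succ, List.flatten_append, List.flatten_singleton, ← ih,
      subst, subst, substFrom_append]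
    simp only [substFrom, List.nil_append, List.append_nil, imageBlock]

/-- The rule `F` picks the image of a letter `a` from the set `I a` of words in `V`, these sets are
disjoint, and `v' ∈ V` belongs to none of them, so that it may replace an image. -/
structure HasAlternative (V : Finset (List β)) (I : α → Set (List β))
    (F : List α → α → List β) (v' : List β) : Prop where
  rule_mem : ∀ u a, F u a ∈ I a
  subset : ∀ a, I a ⊆ V
  eq_of_mem : ∀ ⦃a b x⦄, x ∈ I a → x ∈ I b → a = b
  alternative_mem : v' ∈ V
  alternative_notMem : ∀ a, v' ∉ I a

namespace HasAlternative

variable {V : Finset (List β)} {I : α → Set (List β)}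

theorem replaceRule_mem (h : HasAlternative V I F v') (v : List β) (S : Set ℕ) (u : List α)
    (a : α) : replaceRule F v v' S u a ∈ V := by
  unfold replaceRule
  split_ifs
  exacts [h.alternative_mem, h.subset a (h.rule_mem u a)]

theorem replaceRule_mem_imagesWith (h : HasAlternative V I F v') (v : List β) (S : Set ℕ)
    (u : List α) (a : α) : replaceRule F v v' S u a ∈ imagesWith I v v' a := by
  unfold replaceRule
  split_ifs with hv
  exacts [Or.inr ⟨rfl, hv.1 ▸ h.rule_mem u a⟩, Or.inl (h.rule_mem u a)]

theorem eq_of_mem_imagesWith (h : HasAlternative V I F v') {a b : α}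
    (ha : x ∈ imagesWith I v v' a) (hb : x ∈ imagesWith I v v' b) : a = b := by
  rcases ha with ha | ⟨rfl, ha⟩ <;> rcases hb with hb | ⟨hx, hb⟩
  · exact h.eq_of_mem ha hb
  · exact absurd (hx ▸ ha) (h.alternative_notMem a)
  · exact absurd hb (h.alternative_notMem b)
  · exact h.eq_of_mem ha hb

theorem rule_eq_of_replaceRule_eq (h : HasAlternative V I F v') {u u' : List α} {a a' : α}
    (he : replaceRule F v v' S u a = replaceRule F v v' S u' a') : F u a = F u' a' := by
  have hne : ∀ u a, v' ≠ F u a := fun u a hv =>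
    h.alternative_notMem a (hv ▸ h.rule_mem u a)
  unfold replaceRule at he
  split_ifs at he with hu hu' hu'
  · rw [hu.1, hu'.1]
  · exact absurd he (hne _ _)
  · exact absurd he.symm (hne _ _)
  · exact he

end HasAlternative

theorem HasAlternative.subst_mem_epsThreshold {n L m : ℕ} {ε : ℝ} {V : Finset (List (Fin n))}
    {I : α → Set (List (Fin n))} {F : List α → α → List (Fin n)} {v v' : List (Fin n)} {a : ℕ → α}
    (h : HasAlternative V I F v') (hV : IsBlockCode n L ε V)
    (hO : OverlapCondition n L ε V (imagesWith I v v'))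
    (ha : ∀ i j, i < j → j ≤ i + 2 → j < m → a i ≠ a j)
    (hlong : ∀ k b d x y, 0 < k → 0 < d →
      IsShiftedRun m k (imageBlock (replaceRule F v v' S) a) b d x y →
      ((n : ℝ) - 1) * ((x.length + d * L + y.length : ℕ) + ε) ≤ (k * L : ℕ)) :
    subst (replaceRule F v v' S) (initialWord a m) ∈ epsThreshold n ε := by
  rw [subst_initialWord]
  exact hV.flatten_mem_epsThreshold (fun _ _ _ => h.eq_of_mem_imagesWith) hO ha
    (fun c => h.replaceRule_mem v S _ _) (fun c => h.replaceRule_mem_imagesWith v S _ _) hlong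

end Rules

section MaxCommon

variable {α : Type*} {V : Finset (List α)} {L : ℕ} {u v x : List α}

/-- The lengths of common prefixes of two different words of `V`; `maxCommonPrefix V` is their
supremum. -/
def commonPrefixLengths (V : Finset (List α)) : Set ℕ :=
  {m | ∃ u ∈ V, ∃ v ∈ V, u ≠ v ∧ ∃ x : List α, x <+: u ∧ x <+: v ∧ x.length = m}

/-- The lengths of common suffixes of two different words of `V`; `maxCommonSuffix V` is their
supremum. -/
def commonSuffixLengths (V : Finset (List α)) : Set ℕ :=
  {m | ∃ u ∈ V, ∃ v ∈ V, u ≠ v ∧ ∃ x : List α, x <:+ u ∧ x <:+ v ∧ x.length = m}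

theorem bddAbove_commonPrefixLengths (hV : ∀ v ∈ V, v.length = L) :
    BddAbove (commonPrefixLengths V) := by
  refine ⟨L, ?_⟩
  rintro _ ⟨u, hu, v, -, -, x, hx, -, rfl⟩
  exact hV u hu ▸ hx.length_le

theorem bddAbove_commonSuffixLengths (hV : ∀ v ∈ V, v.length = L) :
    BddAbove (commonSuffixLengths V) := by
  refine ⟨L, ?_⟩
  rintro _ ⟨u, hu, v, -, -, x, hx, -, rfl⟩
  exact hV u hu ▸ hx.length_le

theorem maxCommonPrefix_mem (hV : ∀ v ∈ V, v.length = L) (hnt : V.Nontrivial) :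
    maxCommonPrefix V ∈ commonPrefixLengths V := by
  obtain ⟨u, hu, v, hv, huv⟩ := hnt
  exact Nat.sSup_mem (s := commonPrefixLengths V)
    ⟨0, u, hu, v, hv, huv, [], List.nil_prefix, List.nil_prefix, rfl⟩
    (bddAbove_commonPrefixLengths hV)

theorem maxCommonSuffix_mem (hV : ∀ v ∈ V, v.length = L) (hnt : V.Nontrivial) :
    maxCommonSuffix V ∈ commonSuffixLengths V := by
  obtain ⟨u, hu, v, hv, huv⟩ := hnt
  exact Nat.sSup_mem (s := commonSuffixLengths V)
    ⟨0, u, hu, v, hv, huv, [], List.nil_suffix, List.nil_suffix, rfl⟩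
    (bddAbove_commonSuffixLengths hV)

theorem le_maxCommonPrefix (hV : ∀ v ∈ V, v.length = L) (hu : u ∈ V) (hv : v ∈ V) (huv : u ≠ v)
    (hxu : x <+: u) (hxv : x <+: v) : x.length ≤ maxCommonPrefix V :=
  le_csSup (bddAbove_commonPrefixLengths hV) ⟨u, hu, v, hv, huv, x, hxu, hxv, rfl⟩

theorem le_maxCommonSuffix (hV : ∀ v ∈ V, v.length = L) (hu : u ∈ V) (hv : v ∈ V) (huv : u ≠ v)
    (hxu : x <:+ u) (hxv : x <:+ v) : x.length ≤ maxCommonSuffix V :=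
  le_csSup (bddAbove_commonSuffixLengths hV) ⟨u, hu, v, hv, huv, x, hxu, hxv, rfl⟩

end MaxCommon

section Cyclic

variable {n L m k b d : ℕ} {V : Finset (List (Fin n))} {im : Fin n → Fin 3 → List (Fin n)}
  {v v' x y : List (Fin n)} {a : ℕ → Fin n} {S : Set ℕ}

theorem CyclicConditions.isBlockCode {J : Fin n → Set (List (Fin n))} (hn : 4 ≤ n)
    (hV : V.Nontrivial) (h : CyclicConditions n L V J) : IsBlockCode n L (eps V L) V := by
  have hn' : (4 : ℝ) ≤ n := by exact_mod_cast hn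
  have hL : (3 : ℝ) ≤ L := by exact_mod_cast (by have := h.length_ge; omega : 3 ≤ L)
  have hzero : IsBlockCode n L 0 V := ⟨by omega, le_rfl, zero_le_one, Or.inl rfl, hV,
    h.length_eq, h.per_eq, fun u hu v hv huv => epsThreshold_zero n ▸ (h.pair u hu v hv huv).2⟩
  refine ⟨by omega, div_nonneg (by positivity) (by linarith), ?_, Or.inr h.length_ge, hV,
    h.length_eq, h.per_eq, h.pair⟩
  obtain ⟨u, hu, w, hw, huw, x, hxu, hxw, hx⟩ := maxCommonPrefix_mem h.length_eq hV
  obtain ⟨u', hu', w', hw', huw', x', hxu', hxw', hx'⟩ := maxCommonSuffix_mem h.length_eq hV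
  have hprefix := hzero.mul_le_of_prefix hu hw huw hxu hxw
  have hsuffix := hzero.mul_le_of_suffix hu' hw' huw' hxu' hxw'
  rw [eps, div_le_one (by linarith), ← hx, ← hx']
  nlinarith [(Nat.cast_nonneg x.length : (0 : ℝ) ≤ _), (Nat.cast_nonneg x'.length : (0 : ℝ) ≤ _)]

theorem eps_mul_sub_one {α : Type*} (V : Finset (List α)) (hL : 1 < L) :
    eps V L * ((L : ℝ) - 1) = maxCommonPrefix V + maxCommonSuffix V := by
  have hL' : (1 : ℝ) < L := by exact_mod_cast hL
  rw [eps, div_mul_cancel₀ _ (by linarith)]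

theorem IsShiftedRun.length_add_length_le {B : ℕ → List (Fin n)}
    (hV : ∀ v ∈ V, v.length = L) (hB : ∀ c, B c ∈ V) (hr : IsShiftedRun m k B b d x y) :
    x.length + y.length ≤ maxCommonPrefix V + maxCommonSuffix V := by
  have hx : x.length ≤ maxCommonSuffix V := by
    rcases hr.suff with rfl | ⟨c, -, hne, hx, hx'⟩
    exacts [Nat.zero_le _, le_maxCommonSuffix hV (hB _) (hB _) hne hx hx']
  have hy : y.length ≤ maxCommonPrefix V := by
    rcases hr.pref with rfl | ⟨-, hne, hy, hy'⟩
    exacts [Nat.zero_le _, le_maxCommonPrefix hV (hB _) (hB _) hne hy hy']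
  omega

theorem cyclicRule_eq {α β : Type*} [DecidableEq α] {im : α → Fin 3 → List β}
    (hinj : Function.Injective (Function.uncurry im)) {u u' : List α} {a a' : α}
    (h : cyclicRule im u a = cyclicRule im u' a') :
    a = a' ∧ u.count a ≡ u'.count a' [MOD 3] := by
  have hpair := @hinj (a, ⟨u.count a % 3, _⟩) (a', ⟨u'.count a' % 3, _⟩) h
  have hmod : u.count a % 3 = u'.count a' % 3 := congrArg (fun x => (Prod.snd x).val) hpair
  obtain rfl : a = a' := congrArg Prod.fst hpair
  exact ⟨rfl, hmod⟩

theorem letter_eq_of_imageBlock_cyclicRule_eq {α β : Type*} [DecidableEq α]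
    {im : α → Fin 3 → List β} (hinj : Function.Injective (Function.uncurry im)) {a : ℕ → α}
    {c d : ℕ} (h : imageBlock (cyclicRule im) a c = imageBlock (cyclicRule im) a d) :
    a c = a d ∧ Nat.count (a · = a c) c ≡ Nat.count (a · = a c) d [MOD 3] := by
  obtain ⟨heq, hmod⟩ := cyclicRule_eq hinj h
  rw [← heq, count_initialWord, count_initialWord] at hmod
  exact ⟨heq, hmod⟩

theorem hasAlternative_cyclicRule (hinj : Function.Injective (Function.uncurry im))
    (him : ∀ a i, im a i ∈ V) (hv'V : v' ∈ V) (hv' : ∀ a i, v' ≠ im a i) :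
    HasAlternative V (fun a => Set.range (im a)) (cyclicRule im) v' where
  rule_mem _ _ := ⟨_, rfl⟩
  subset a := Set.range_subset_iff.2 (him a)
  eq_of_mem := by
    rintro a b _ ⟨i, rfl⟩ ⟨j, hj⟩
    exact congrArg Prod.fst (@hinj (a, i) (b, j) hj.symm)
  alternative_mem := hv'V
  alternative_notMem := by
    rintro a ⟨i, hi⟩
    exact hv' a i hi.symm

/-- Equal blocks are images of occurrences of a letter whose numbers agree modulo `3`; hence the
period of the preimage is large enough for the bound with `ε`, and `ε * (L - 1) = l(V) + r(V)`
leaves room for the two incomplete blocks. -/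
theorem CyclicConditions.mul_le_of_shiftedRun (hn : 4 ≤ n) (hV : V.Nontrivial)
    (h : CyclicConditions n L V (imagesWith (fun a => Set.range (im a)) v v'))
    (hinj : Function.Injective (Function.uncurry im))
    (hF : HasAlternative V (fun a => Set.range (im a)) (cyclicRule im) v')
    (ha : initialWord a m ∈ epsThreshold n (eps V L)) (hk : 0 < k) (hd : 0 < d)
    (hr : IsShiftedRun m k (imageBlock (replaceRule (cyclicRule im) v v' S) a) b d x y) :
    ((n : ℝ) - 1) * ((x.length + d * L + y.length : ℕ) + eps V L) ≤ (k * L : ℕ) := by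
  have hC := h.isBlockCode hn hV
  have htwo := hC.two_le_sub_one
  have hm := hr.add_le
  have hletters : ∀ c, b ≤ c → c < b + d →
      a c = a (c + k) ∧ Nat.count (a · = a c) c ≡ Nat.count (a · = a c) (c + k) [MOD 3] :=
    fun c hbc hcd => letter_eq_of_imageBlock_cyclicRule_eq hinj
      (hF.rule_eq_of_replaceRule_eq (hr.eq c hbc hcd))
  have hlong : b + 3 * (n - 1) ≤ b + k := by
    obtain ⟨heq, hmod⟩ := hletters b le_rfl (by omega)
    exact add_mul_le_of_letter_eq (by omega) ha.2 (by omega) (by omega) heq hmod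
  have hbound : ((n : ℝ) - 1) * (d + eps V L) ≤ k :=
    ((mem_epsThreshold_iff (by omega) hC.eps_le_one).1 ha b k d hk
      ⟨by rw [length_initialWord]; omega, fun t ht => by
        rw [getElem?_initialWord (by omega), getElem?_initialWord (by omega),
          (hletters (b + t) (by omega) (by omega)).1, add_right_comm]⟩).2 (by omega)
  have heps := eps_mul_sub_one V (L := L) (by have := h.length_ge; omega)
  have hxy : (x.length + y.length : ℝ) ≤ maxCommonPrefix V + maxCommonSuffix V := by
    exact_mod_cast hr.length_add_length_le h.length_eq fun c => hF.replaceRule_mem v S _ _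
  push_cast
  calc ((n : ℝ) - 1) * (x.length + d * L + y.length + eps V L)
      ≤ ((n : ℝ) - 1) * ((d + eps V L) * L) :=
        mul_le_mul_of_nonneg_left (by linarith) (by linarith)
    _ = ((n : ℝ) - 1) * (d + eps V L) * L := by ring
    _ ≤ k * L := mul_le_mul_of_nonneg_right hbound (by positivity)

theorem CyclicConditions.subst_mem_epsThreshold (hn : 4 ≤ n) (hV : V.Nontrivial)
    (h : CyclicConditions n L V (imagesWith (fun a => Set.range (im a)) v v'))
    (hinj : Function.Injective (Function.uncurry im))
    (hF : HasAlternative V (fun a => Set.range (im a)) (cyclicRule im) v')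
    (ha : initialWord a m ∈ epsThreshold n (eps V L)) :
    subst (replaceRule (cyclicRule im) v v' S) (initialWord a m) ∈ epsThreshold n (eps V L) :=
  hF.subst_mem_epsThreshold (h.isBlockCode hn hV) h.overlap
    (fun i j hij hj hjm he => by
      have := add_le_of_letter_eq (by omega) ha.2 hij hjm he
      omega)
    fun _ _ _ _ _ hk hd hr => h.mul_le_of_shiftedRun hn hV hinj hF ha hk hd hr

end Cyclic

section Morphism

variable {n M L m k b d : ℕ} {V : Finset (List (Fin n))} {f : Fin M → List (Fin n)}
  {v v' x y : List (Fin n)} {a : ℕ → Fin M} {S : Set ℕ}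

theorem hasAlternative_morphismRule (hinj : Function.Injective f) (hf : ∀ a, f a ∈ V)
    (hv'V : v' ∈ V) (hv' : ∀ a, v' ≠ f a) :
    HasAlternative V (fun a => {f a}) (morphismRule f) v' where
  rule_mem _ _ := rfl
  subset a := Set.singleton_subset_iff.2 (hf a)
  eq_of_mem := by
    rintro a b x rfl hb
    exact hinj hb
  alternative_mem := hv'V
  alternative_notMem := hv'

/-- The preimage returns on both sides of the run: if `a c` precedes it, then
`a (c + n + 2) = a c`. Both incomplete blocks are thus parts of images of `a c`, and the overlap
condition at this letter bounds their total length. -/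
theorem IsBlockCode.mul_le_of_shiftedRun_one {J : Fin (n + 1) → Set (List (Fin n))}
    {a : ℕ → Fin (n + 1)} {B : ℕ → List (Fin n)} (hV : IsBlockCode n L 0 V)
    (hJ : ∀ ⦃a b x⦄, x ∈ J a → x ∈ J b → a = b) (hO : OverlapCondition n L 0 V J)
    (ha : initialWord a m ∈ threshold (n + 1)) (hB : ∀ c, B c ∈ V) (hBJ : ∀ c, B c ∈ J (a c))
    (hr : IsShiftedRun m n B b 1 x y) :
    ((n : ℝ) - 1) * (x.length + y.length) ≤ L := by
  have hn := hV.three_le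
  have hleft := hV.mul_le_of_shiftedRun_left hB hr
  have hright := hV.mul_le_of_shiftedRun_right hB hr
  rw [add_zero] at hleft hright
  rcases hr.suff with rfl | ⟨c, rfl, -, hxc, hxn⟩
  · simpa using hright
  rcases hr.pref with rfl | ⟨hm, -, hyc, hyn⟩
  · simpa using hleft
  have hreturn : a (c + 1) = a (c + (n + 1)) := by
    rw [show c + (n + 1) = c + 1 + n by omega]
    exact hJ (hBJ _) (hr.eq (c + 1) le_rfl (by omega) ▸ hBJ _)
  obtain ⟨hne, heq⟩ := letter_ne_and_eq_of_return (by omega) ha (by omega) hreturn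
  rw [Nat.add_sub_cancel] at hne
  have hgap : ∀ i j, i < j → j < i + n → j < m → a i ≠ a j := fun i j hij hjn hjm he => by
    have := add_le_of_letter_eq (by omega) ha hij hjm he
    omega
  have hlast : B (c + 1 + 1 + n) ∈ J (a c) := by
    rw [← heq, show c + (n + 1) + 1 = c + 1 + 1 + n by omega]
    exact hBJ _
  have hbound := hO.mul_le (by omega) hJ (hgap c (c + 1 + 1) (by omega) (by omega) (by omega)).symm
    hne.symm (hgap (c + 1 + 1) (c + n) (by omega) (by omega) (by omega)) (hB _) (hBJ _) (hB _)
    (hBJ _) hlast (hBJ c) hyc hyn hxc hxn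
  rwa [add_zero] at hbound

theorem IsBlockCode.mul_le_of_shiftedRun_of_lt {J : Fin M → Set (List (Fin n))}
    {B : ℕ → List (Fin n)} (hV : IsBlockCode n L 0 V) (hM : n < M)
    (hJ : ∀ ⦃a b x⦄, x ∈ J a → x ∈ J b → a = b) (hO : OverlapCondition n L 0 V J)
    (ha : initialWord a m ∈ threshold M) (hB : ∀ c, B c ∈ V) (hBJ : ∀ c, B c ∈ J (a c))
    (hk : 0 < k) (hd : 0 < d) (hr : IsShiftedRun m k B b d x y) :
    ((n : ℝ) - 1) * (x.length + d * L + y.length) ≤ k * L := by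
  have hn := hV.three_le
  have hm := hr.add_le
  have hletters : (M - 1) * d ≤ k := mul_le_of_letters_eq (i := b) (by omega) ha hk (by omega)
    fun t ht => by
      rw [add_right_comm]
      exact hJ (hBJ _) (hr.eq (b + t) (by omega) (by omega) ▸ hBJ _)
  obtain ⟨l, hl, rfl⟩ : ∃ l, 0 < l ∧ M = n + l := ⟨M - n, by omega, by omega⟩
  rw [show n + l - 1 = n - 1 + l by omega, Nat.add_mul] at hletters
  by_cases hlong : (n - 1) * d + 2 ≤ k
  · have hleft := hV.mul_le_of_shiftedRun_left hB hr
    have hright := hV.mul_le_of_shiftedRun_right hB hr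
    have hlong' : (((n : ℝ) - 1) * d + 2) * L ≤ k * L := by
      refine mul_le_mul_of_nonneg_right ?_ (Nat.cast_nonneg L)
      rw [← Nat.cast_pred (by omega)]
      exact_mod_cast hlong
    linarith
  · obtain ⟨rfl, rfl⟩ : l = 1 ∧ d = 1 := by
      have := Nat.mul_pos hl hd
      exact mul_eq_one.1 (by omega)
    obtain rfl : k = n := by omega
    have hbound := hV.mul_le_of_shiftedRun_one hJ hO ha hB hBJ hr
    push_cast
    linarith

theorem IsBlockCode.subst_mem_threshold (hV : IsBlockCode n L 0 V) (hM : n < M)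
    (hO : OverlapCondition n L 0 V (imagesWith (fun a => {f a}) v v'))
    (hF : HasAlternative V (fun a => {f a}) (morphismRule f) v')
    (ha : initialWord a m ∈ threshold M) :
    subst (replaceRule (morphismRule f) v v' S) (initialWord a m) ∈ threshold n := by
  have hn := hV.three_le
  rw [← epsThreshold_zero]
  refine hF.subst_mem_epsThreshold hV hO (fun i j hij hj hjm he => ?_)
    fun k b d x y hk hd hr => ?_
  · have := add_le_of_letter_eq (by omega) ha hij hjm he
    omega
  · rw [add_zero]
    exact_mod_cast hV.mul_le_of_shiftedRun_of_lt hM (fun _ _ _ => hF.eq_of_mem_imagesWith) hO ha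
      (fun _ => hF.replaceRule_mem _ _ _ _) (fun _ => hF.replaceRule_mem_imagesWith _ _ _ _)
      hk hd hr

end Morphism

section LevelTrees

variable {β : Type*} {T : Set (List β)} {Q : Set ℕ} {x : List β} {lo hi m : ℕ}

/-- A tree of words without leaves whose branching vertices are exactly the vertices with length
in `Q`. -/
structure BranchesAtLevels (T : Set (List β)) (Q : Set ℕ) : Prop where
  nil_mem : [] ∈ T
  mem_of_prefix : ∀ ⦃x y⦄, x <+: y → y ∈ T → x ∈ T
  exists_child : ∀ x ∈ T, ∃ e, x ++ [e] ∈ T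
  isBranching_iff : ∀ x ∈ T, IsBranching T x ↔ x.length ∈ Q

namespace BranchesAtLevels

theorem mem_of_isBranching (h : BranchesAtLevels T Q) (hx : IsBranching T x) : x ∈ T := by
  obtain ⟨c, -, -, hc, -⟩ := hx
  exact h.mem_of_prefix (List.prefix_append _ _) hc

theorem nonempty_letters (h : BranchesAtLevels T Q) : Nonempty β :=
  let ⟨e, _⟩ := h.exists_child [] h.nil_mem
  ⟨e⟩

theorem exists_extension (h : BranchesAtLevels T Q) (hx : x ∈ T) (hm : x.length ≤ m) :
    ∃ y ∈ T, x <+: y ∧ y.length = m := by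
  induction m, hm using Nat.le_induction with
  | base => exact ⟨x, hx, List.prefix_rfl, rfl⟩
  | succ m _ ih =>
    obtain ⟨y, hy, hxy, rfl⟩ := ih
    obtain ⟨e, he⟩ := h.exists_child y hy
    exact ⟨_, he, hxy.trans (List.prefix_append _ _), List.length_append⟩

theorem exists_isBranching (h : BranchesAtLevels T Q)
    (hwindow : ∀ i, ∃ j, i ≤ j ∧ j < i + hi ∧ j ∈ Q) (hx : x ∈ T) :
    ∃ y, IsBranching T y ∧ x <+: y ∧ y.length < x.length + hi := by
  obtain ⟨j, hxj, hj, hjQ⟩ := hwindow x.length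
  obtain ⟨y, hy, hxy, rfl⟩ := h.exists_extension hx hxj
  exact ⟨y, (h.isBranching_iff y hy).2 hjQ, hxy, hj⟩

theorem le_length_and_length_le_of_areNeighbours (h : BranchesAtLevels T Q)
    (hgap : ∀ i ∈ Q, ∀ j ∈ Q, i < j → i + lo ≤ j)
    (hwindow : ∀ i, ∃ j, i ≤ j ∧ j < i + hi ∧ j ∈ Q) {y : List β} (hxy : AreNeighbours T x y) :
    x.length + lo ≤ y.length ∧ y.length ≤ x.length + hi := by
  obtain ⟨hx, hy, hpre, hne, hnext⟩ := hxy
  have hxT := h.mem_of_isBranching hx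
  have hyT := h.mem_of_isBranching hy
  have hlt : x.length < y.length :=
    lt_of_le_of_ne hpre.length_le fun he => hne (hpre.eq_of_length he)
  refine ⟨hgap _ ((h.isBranching_iff x hxT).1 hx) _ ((h.isBranching_iff y hyT).1 hy) hlt, ?_⟩
  obtain ⟨j, hxj, hj, hjQ⟩ := hwindow (x.length + 1)
  suffices y.length ≤ j by omega
  by_contra! hjy
  have hlen : (y.take j).length = j := List.length_take_of_le hjy.le
  have hz : IsBranching T (y.take j) :=
    (h.isBranching_iff _ (h.mem_of_prefix (List.take_prefix j y) hyT)).2 (hlen.symm ▸ hjQ)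
  have hxz : x <+: y.take j :=
    List.prefix_of_prefix_length_le hpre (List.take_prefix j y) (by omega)
  rcases hnext _ hz hxz (List.take_prefix j y) with he | he
  · rw [he] at hlen
    omega
  · rw [he] at hlen
    omega

theorem finite_level [Finite β] (T : Set (List β)) (m : ℕ) : {x ∈ T | x.length = m}.Finite :=
  (List.finite_length_eq β m).subset fun _ hx => hx.2

theorem ncard_level_le_succ [Finite β] (h : BranchesAtLevels T Q) (m : ℕ) :
    {x ∈ T | x.length = m}.ncard ≤ {x ∈ T | x.length = m + 1}.ncard := by
  have : Nonempty β := h.nonempty_letters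
  choose! e he using h.exists_child
  refine Set.ncard_le_ncard_of_injOn (fun x => x ++ [e x]) ?_ ?_ (finite_level T _)
  · rintro x ⟨hx, rfl⟩
    exact ⟨he x hx, List.length_append⟩
  · intro x _ y _ hxy
    exact (List.append_inj' hxy rfl).1

theorem two_mul_ncard_level_le_succ [Finite β] (h : BranchesAtLevels T Q) (hm : m ∈ Q) :
    2 * {x ∈ T | x.length = m}.ncard ≤ {x ∈ T | x.length = m + 1}.ncard := by
  have hbranch : ∀ x ∈ {x ∈ T | x.length = m}, IsBranching T x := by
    rintro x ⟨hx, rfl⟩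
    exact (h.isBranching_iff x hx).2 hm
  have : Nonempty β := h.nonempty_letters
  choose! c d hcd hc hd using hbranch
  have himage : ∀ e : List β → β, ((fun x => x ++ [e x]) '' {x ∈ T | x.length = m}).ncard =
      {x ∈ T | x.length = m}.ncard := fun e =>
    Set.InjOn.ncard_image fun x _ y _ hxy => (List.append_inj' hxy rfl).1
  have hdisjoint : Disjoint ((fun x => x ++ [c x]) '' {x ∈ T | x.length = m})
      ((fun x => x ++ [d x]) '' {x ∈ T | x.length = m}) := by
    rw [Set.disjoint_left]
    rintro _ ⟨x, hx, rfl⟩ ⟨y, -, hyx⟩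
    obtain ⟨rfl, hdc⟩ := List.append_inj' hyx rfl
    exact hcd y hx (List.singleton_inj.1 hdc).symm
  have hfinite := finite_level T m
  rw [two_mul]
  nth_rewrite 1 [← himage c]
  rw [← himage d, ← Set.ncard_union_eq hdisjoint (hfinite.image _) (hfinite.image _)]
  refine Set.ncard_le_ncard ?_ (finite_level T _)
  rintro _ (⟨x, hx, rfl⟩ | ⟨x, hx, rfl⟩)
  · exact ⟨hc x hx, by rw [List.length_append, hx.2]; rfl⟩
  · exact ⟨hd x hx, by rw [List.length_append, hx.2]; rfl⟩

open Classical in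
theorem two_pow_count_le_ncard [Finite β] (h : BranchesAtLevels T Q) (m : ℕ) :
    2 ^ Nat.count (· ∈ Q) m ≤ {x ∈ T | x.length = m}.ncard := by
  induction m with
  | zero =>
    rw [Nat.count_zero, pow_zero]
    exact (Set.ncard_pos (finite_level T 0)).2 ⟨[], h.nil_mem, rfl⟩
  | succ m ih =>
    rw [Nat.count_succ]
    split_ifs with hm
    · rw [pow_succ']
      exact (Nat.mul_le_mul_left 2 ih).trans (h.two_mul_ncard_level_le_succ hm)
    · exact ih.trans (h.ncard_level_le_succ m)

theorem uniformlyGrowing [Finite β] (h : BranchesAtLevels T Q)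
    (hgap : ∀ i ∈ Q, ∀ j ∈ Q, i < j → i + lo ≤ j)
    (hwindow : ∀ i, ∃ j, i ≤ j ∧ j < i + hi ∧ j ∈ Q) : UniformlyGrowing T lo hi where
  branches _ hx := h.exists_isBranching hwindow hx
  distance _ _ hxy := h.le_length_and_length_le_of_areNeighbours hgap hwindow hxy
  growth m := by
    classical
    have hcount := count_add_le_count hwindow 0 (m / hi)
    rw [Nat.count_zero, zero_add, zero_add] at hcount
    exact (Nat.pow_le_pow_right two_pos
      (hcount.trans (Nat.count_monotone _ (Nat.div_mul_le_self m hi)))).trans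
      (h.two_pow_count_le_ncard m)

end BranchesAtLevels

end LevelTrees

section ReplacementTree

variable {α β : Type*} {F : List α → α → List β} {v v' x : List β} {ω : ℕ → α} {S S' : Set ℕ}
  {L c j δ : ℕ}

theorem imageBlock_replaceRule_of_mem (hc : imageBlock F ω c = v) (hS : c ∈ S) :
    imageBlock (replaceRule F v v' S) ω c = v' :=
  if_pos ⟨hc, by rwa [length_initialWord]⟩

theorem imageBlock_replaceRule_of_notMem (hS : c ∉ S) :
    imageBlock (replaceRule F v v' S) ω c = imageBlock F ω c :=
  if_neg fun h => hS (by simpa only [length_initialWord] using h.2)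

theorem imageBlock_replaceRule_of_ne (hc : imageBlock F ω c ≠ v) :
    imageBlock (replaceRule F v v' S) ω c = imageBlock F ω c :=
  if_neg fun h => hc h.1

theorem imageBlock_replaceRule_congr (h : c ∈ S ↔ c ∈ S') :
    imageBlock (replaceRule F v v' S) ω c = imageBlock (replaceRule F v v' S') ω c := by
  by_cases hc : imageBlock F ω c = v
  · by_cases hS : c ∈ S
    · rw [imageBlock_replaceRule_of_mem hc hS, imageBlock_replaceRule_of_mem hc (h.1 hS)]
    · rw [imageBlock_replaceRule_of_notMem hS,
        imageBlock_replaceRule_of_notMem fun hS' => hS (h.2 hS')]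
  · rw [imageBlock_replaceRule_of_ne hc, imageBlock_replaceRule_of_ne hc]

theorem length_imageBlock_replaceRule (hF : ∀ c, (imageBlock F ω c).length = L)
    (hv' : v'.length = L) (S : Set ℕ) (c : ℕ) :
    (imageBlock (replaceRule F v v' S) ω c).length = L := by
  by_cases hc : imageBlock F ω c = v ∧ c ∈ S
  · rw [imageBlock_replaceRule_of_mem hc.1 hc.2, hv']
  · rcases not_and_or.1 hc with hc | hS
    · rw [imageBlock_replaceRule_of_ne hc, hF]
    · rw [imageBlock_replaceRule_of_notMem hS, hF]

theorem mem_replacementTree_iff (hF : ∀ c, (imageBlock F ω c).length = L) (hv' : v'.length = L)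
    (hL : 0 < L) : x ∈ replacementTree F v v' ω ↔ ∃ S, ∀ j < x.length,
      x[j]? = blockLetter L (imageBlock (replaceRule F v v' S) ω) j := by
  have hlen := length_imageBlock_replaceRule (v := v) hF hv'
  simp only [replacementTree, Set.mem_ofPred_eq, subst_initialWord, List.prefix_iff_getElem?]
  refine exists_congr fun S => ⟨?_, fun hx => ⟨x.length, fun j hj => ?_⟩⟩
  · rintro ⟨m, hx⟩ j hj
    have hjm : j < m * L := by
      rw [← length_flatten_initialWord (hlen S) m]
      exact (List.getElem?_eq_some_iff.1 (hx j hj)).1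
    rw [← getElem?_flatten_initialWord (hlen S) hjm, hx j hj, List.getElem?_eq_getElem hj]
  · rw [getElem?_flatten_initialWord (hlen S) (hj.trans_le (Nat.le_mul_of_pos_right _ hL)),
      ← hx j hj, List.getElem?_eq_getElem hj]

theorem concat_mem_replacementTree_iff (hF : ∀ c, (imageBlock F ω c).length = L)
    (hv' : v'.length = L) (hL : 0 < L) {e : β} : x ++ [e] ∈ replacementTree F v v' ω ↔
      ∃ S, (∀ j < x.length, x[j]? = blockLetter L (imageBlock (replaceRule F v v' S) ω) j) ∧
        blockLetter L (imageBlock (replaceRule F v v' S) ω) x.length = some e := by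
  rw [mem_replacementTree_iff hF hv' hL]
  refine exists_congr fun S => ?_
  simp only [List.length_append, List.length_singleton, Nat.forall_lt_succ_right,
    List.getElem?_concat_length, eq_comm (a := some e)]
  exact and_congr_left fun _ => forall₂_congr fun j hj => by rw [List.getElem?_append_left hj]

theorem blockLetter_replaceRule_congr (hprefix : ∀ t < δ, v[t]? = v'[t]?)
    (h : imageBlock F ω (j / L) = v → (j / L ∈ S ↔ j / L ∈ S') ∨ j % L < δ) :
    blockLetter L (imageBlock (replaceRule F v v' S) ω) j =
      blockLetter L (imageBlock (replaceRule F v v' S') ω) j := by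
  unfold blockLetter
  by_cases hc : imageBlock F ω (j / L) = v
  · rcases h hc with hS | hδ
    · rw [imageBlock_replaceRule_congr hS]
    · have hletter : ∀ S, (imageBlock (replaceRule F v v' S) ω (j / L))[j % L]? = v[j % L]? := by
        intro S
        by_cases hS : j / L ∈ S
        · rw [imageBlock_replaceRule_of_mem hc hS, hprefix _ hδ]
        · rw [imageBlock_replaceRule_of_notMem hS, hc]
      rw [hletter, hletter]
  · rw [imageBlock_replaceRule_of_ne hc, imageBlock_replaceRule_of_ne hc]

theorem exists_eq_of_isBranching (hF : ∀ c, (imageBlock F ω c).length = L) (hv' : v'.length = L)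
    (hδL : δ < L) (hprefix : ∀ t < δ, v[t]? = v'[t]?) (hδ : v[δ]? ≠ v'[δ]?)
    (hx : IsBranching (replacementTree F v v' ω) x) :
    ∃ c, imageBlock F ω c = v ∧ x.length = c * L + δ := by
  obtain ⟨e, e', hne, he, he'⟩ := hx
  rw [concat_mem_replacementTree_iff hF hv' (by omega)] at he he'
  obtain ⟨S, hxS, heS⟩ := he
  obtain ⟨S', hxS', heS'⟩ := he'
  have hsplit : ¬ (imageBlock F ω (x.length / L) = v →
      (x.length / L ∈ S ↔ x.length / L ∈ S') ∨ x.length % L < δ) := fun h => by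
    have := blockLetter_replaceRule_congr hprefix h
    rw [heS, heS'] at this
    exact hne (Option.some.inj this)
  push Not at hsplit
  obtain ⟨hc, hSS', hδx⟩ := hsplit
  refine ⟨x.length / L, hc, ?_⟩
  have hdiv := Nat.div_add_mod' x.length L
  by_contra hlen
  have hletter := (hxS (x.length / L * L + δ) (by omega)).symm.trans (hxS' _ (by omega))
  rw [blockLetter_mul_add hδL, blockLetter_mul_add hδL] at hletter
  rcases hSS' with ⟨hS, hS'⟩ | ⟨hS, hS'⟩
  · rw [imageBlock_replaceRule_of_mem hc hS, imageBlock_replaceRule_of_notMem hS', hc] at hletter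
    exact hδ hletter.symm
  · rw [imageBlock_replaceRule_of_notMem hS, imageBlock_replaceRule_of_mem hc hS', hc] at hletter
    exact hδ hletter

theorem isBranching_of_eq (hF : ∀ c, (imageBlock F ω c).length = L) (hv' : v'.length = L)
    (hδL : δ < L) (hprefix : ∀ t < δ, v[t]? = v'[t]?) (hδ : v[δ]? ≠ v'[δ]?)
    (hx : x ∈ replacementTree F v v' ω) (hc : imageBlock F ω c = v)
    (hlen : x.length = c * L + δ) : IsBranching (replacementTree F v v' ω) x := by
  have hL : 0 < L := by omega
  have hδv : δ < v.length := by rwa [← hc, hF]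
  obtain ⟨S, hS⟩ := (mem_replacementTree_iff hF hv' hL).1 hx
  have hmem : ∀ S' : Set ℕ, ∀ e, (∀ d, d ≠ c → (d ∈ S ↔ d ∈ S')) →
      (imageBlock (replaceRule F v v' S') ω c)[δ]? = some e →
      x ++ [e] ∈ replacementTree F v v' ω := fun S' e hSS' he => by
    refine (concat_mem_replacementTree_iff hF hv' hL).2 ⟨S', fun j hj => ?_, ?_⟩
    · rw [hS j hj]
      refine blockLetter_replaceRule_congr hprefix fun _ => ?_
      by_cases hjc : j / L = c
      · have hdiv := Nat.div_add_mod' j L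
        rw [hjc] at hdiv
        exact Or.inr (by omega)
      · exact Or.inl (hSS' _ hjc)
    · rw [hlen, blockLetter_mul_add hδL, he]
  refine ⟨v[δ], v'[δ], fun he => hδ ?_, hmem (S \ {c}) _ (fun d hd => by simp [hd]) ?_,
    hmem (insert c S) _ (fun d hd => by simp [hd]) ?_⟩
  · rw [List.getElem?_eq_getElem hδv, List.getElem?_eq_getElem, he]
  · rw [imageBlock_replaceRule_of_notMem (by simp), hc, List.getElem?_eq_getElem]
  · rw [imageBlock_replaceRule_of_mem hc (Set.mem_insert c S), List.getElem?_eq_getElem]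

theorem branchesAtLevels_replacementTree (hF : ∀ c, (imageBlock F ω c).length = L)
    (hv' : v'.length = L) (hδL : δ < L) (hprefix : ∀ t < δ, v[t]? = v'[t]?)
    (hδ : v[δ]? ≠ v'[δ]?) : BranchesAtLevels (replacementTree F v v' ω)
      {i | ∃ c, imageBlock F ω c = v ∧ i = c * L + δ} where
  nil_mem := ⟨∅, 0, List.nil_prefix⟩
  mem_of_prefix := by
    rintro x y hxy ⟨S, m, hy⟩
    exact ⟨S, m, hxy.trans hy⟩
  exists_child x hx := by
    have hL : 0 < L := by omega
    obtain ⟨S, hS⟩ := (mem_replacementTree_iff hF hv' hL).1 hx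
    have hr : x.length % L < (imageBlock (replaceRule F v v' S) ω (x.length / L)).length := by
      rw [length_imageBlock_replaceRule hF hv']
      exact Nat.mod_lt _ hL
    exact ⟨_, (concat_mem_replacementTree_iff hF hv' hL).2
      ⟨S, hS, List.getElem?_eq_getElem hr⟩⟩
  isBranching_iff x hx := ⟨exists_eq_of_isBranching hF hv' hδL hprefix hδ,
    fun ⟨_, hc, hlen⟩ => isBranching_of_eq hF hv' hδL hprefix hδ hx hc hlen⟩

theorem exists_first_difference (hv : v.length = L) (hv' : v'.length = L) (hne : v ≠ v') :
    ∃ δ < L, (∀ t < δ, v[t]? = v'[t]?) ∧ v[δ]? ≠ v'[δ]? := by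
  classical
  have hdiff : ∃ t : ℕ, v[t]? ≠ v'[t]? := by
    by_contra! h
    exact hne (List.ext_getElem? h)
  have hδ := Nat.find_spec hdiff
  refine ⟨Nat.find hdiff, ?_, fun t ht => by simpa using Nat.find_min hdiff ht, hδ⟩
  by_contra! hL
  exact hδ (by rw [List.getElem?_eq_none (by omega), List.getElem?_eq_none (by omega)])

theorem uniformlyGrowing_replacementTree [Finite β] (hF : ∀ c, (imageBlock F ω c).length = L)
    (hv : v.length = L) (hv' : v'.length = L) (hne : v ≠ v') {lo H : ℕ}
    (hgap : ∀ c d, c < d → imageBlock F ω c = v → imageBlock F ω d = v → c + lo ≤ d)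
    (hwindow : ∀ c, ∃ d, c ≤ d ∧ d < c + H ∧ imageBlock F ω d = v) :
    UniformlyGrowing (replacementTree F v v' ω) (lo * L) (H * L) := by
  obtain ⟨δ, hδL, hprefix, hδ⟩ := exists_first_difference hv hv' hne
  refine (branchesAtLevels_replacementTree hF hv' hδL hprefix hδ).uniformlyGrowing ?_ fun i => ?_
  · rintro _ ⟨c, hc, rfl⟩ _ ⟨d, hd, rfl⟩ hlt
    have hcd : c < d := Nat.lt_of_mul_lt_mul_right (a := L) (by omega)
    have := Nat.mul_le_mul_right L (hgap c d hcd hc hd)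
    rw [Nat.add_mul] at this
    omega
  · obtain ⟨b, hib, hbi⟩ : ∃ b, i ≤ b * L + δ ∧ b * L + δ < i + L := by
      have hdiv := Nat.div_add_mod' (i + (L - 1 - δ)) L
      have hmod := Nat.mod_lt (i + (L - 1 - δ)) (by omega : 0 < L)
      exact ⟨(i + (L - 1 - δ)) / L, by omega, by omega⟩
    obtain ⟨c, hbc, hcb, hc⟩ := hwindow b
    have hlower := Nat.mul_le_mul_right L hbc
    have hupper := Nat.mul_le_mul_right L (Nat.succ_le_of_lt hcb)
    rw [Nat.succ_mul, Nat.add_mul] at hupper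
    exact ⟨c * L + δ, by omega, by omega, c, hc, rfl⟩

end ReplacementTree

section ReplacementsGrow

variable {α β : Type*} {L lo hi : ℕ} {F : List α → α → List β} {v v' : List β}
  {X : Set (List α)} {Y : Set (List β)}

/-- Replacing `v` by `v'` in the images of words of `X` under the rule `F` gives words of `Y`, and
for every infinite word with prefixes in `X` the tree of all replacements lies in `Y` and is
uniformly growing: the conclusion shared by the two parts of the theorem. -/
def ReplacementsGrow (F : List α → α → List β) (v v' : List β) (X : Set (List α))
    (Y : Set (List β)) (lo hi : ℕ) : Prop :=
  (∀ w ∈ X, ∀ S : Set ℕ, subst (replaceRule F v v' S) w ∈ Y) ∧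
    ∀ ω : ℕ → α, (∀ m, initialWord ω m ∈ X) →
      replacementTree F v v' ω ⊆ Y ∧ UniformlyGrowing (replacementTree F v v' ω) lo hi

theorem replacementsGrow [Nonempty α] [Finite β] (hY : ∀ ⦃x y⦄, x <:+: y → y ∈ Y → x ∈ Y)
    (hF : ∀ u a, (F u a).length = L) (hv : v.length = L) (hv' : v'.length = L) (hne : v ≠ v')
    (hsubst : ∀ a m S, initialWord a m ∈ X → subst (replaceRule F v v' S) (initialWord a m) ∈ Y)
    (hgap : ∀ ω, (∀ m, initialWord ω m ∈ X) → ∀ c d, c < d → imageBlock F ω c = v →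
      imageBlock F ω d = v → c + lo ≤ d)
    (hwindow : ∀ ω, (∀ m, initialWord ω m ∈ X) → ∀ c, ∃ d, c ≤ d ∧ d < c + hi ∧
      imageBlock F ω d = v) : ReplacementsGrow F v v' X Y (lo * L) (hi * L) := by
  refine ⟨fun w hw S => ?_, fun ω hω => ⟨?_, uniformlyGrowing_replacementTree
    (fun _ => hF _ _) hv hv' hne (hgap ω hω) (hwindow ω hω)⟩⟩
  · obtain ⟨a, ha⟩ := exists_eq_initialWord w
    rw [ha] at hw ⊢
    exact hsubst a _ S hw
  · rintro x ⟨S, m, hx⟩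
    exact hY hx.isInfix (hsubst ω m S (hω m))

end ReplacementsGrow

section Growth

variable {n M L : ℕ} {V : Finset (List (Fin n))} {v' : List (Fin n)}

theorem exists_imageBlock_cyclicRule_eq {β : Type*} (hM : 2 ≤ M) (im : Fin M → Fin 3 → List β)
    {ω : ℕ → Fin M} (hω : ∀ m, initialWord ω m ∈ threshold M) (b : Fin M) (i : Fin 3) (c : ℕ) :
    ∃ d, c ≤ d ∧ d < c + 3 * (M + 1) ∧ imageBlock (cyclicRule im) ω d = im b i := by
  obtain ⟨d, hcd, hd, hb, hi⟩ := exists_count_modEq (P := (ω · = b))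
    (fun j => exists_letter_eq hM (hω _) le_rfl b) three_pos c i
  refine ⟨d, hcd, hd, ?_⟩
  rw [imageBlock, hb]
  refine congrArg (im b) (Fin.ext ?_)
  change (initialWord ω d).count b % 3 = i
  rw [count_initialWord, hi, Nat.mod_eq_of_lt i.isLt]

theorem CyclicConditions.replacementsGrow {im : Fin n → Fin 3 → List (Fin n)} {b : Fin n}
    {i : Fin 3} (h : CyclicConditions n L V (imagesWith (fun a => Set.range (im a)) (im b i) v'))
    (hn : 4 ≤ n) (hinj : Function.Injective (Function.uncurry im)) (him : ∀ a i, im a i ∈ V)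
    (hv'V : v' ∈ V) (hv' : ∀ a i, v' ≠ im a i) :
    ReplacementsGrow (cyclicRule im) (im b i) v' (epsThreshold n (eps V L))
      (epsThreshold n (eps V L)) (3 * (n - 1) * L) (3 * (n + 1) * L) := by
  have : Nonempty (Fin n) := ⟨b⟩
  have hne : im b i ≠ v' := (hv' b i).symm
  have hV : V.Nontrivial := ⟨_, him b i, _, hv'V, hne⟩
  refine ThresholdWords.replacementsGrow (fun _ _ => epsThreshold_of_infix)
    (fun _ _ => h.length_eq _ (him _ _)) (h.length_eq _ (him b i)) (h.length_eq _ hv'V) hne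
    (fun a m S ha => h.subst_mem_epsThreshold hn hV hinj
      (hasAlternative_cyclicRule hinj him hv'V hv') ha)
    (fun ω hω c d hcd hc hd => ?_)
    fun ω hω => exists_imageBlock_cyclicRule_eq (by omega) im (fun m => (hω m).2) b i
  obtain ⟨heq, hmod⟩ := letter_eq_of_imageBlock_cyclicRule_eq hinj (hc.trans hd.symm)
  exact add_mul_le_of_letter_eq (by omega) (hω (d + 1)).2 hcd (Nat.lt_succ_self d) heq hmod

theorem IsBlockCode.replacementsGrow {f : Fin M → List (Fin n)} {b : Fin M}
    (h : IsBlockCode n L 0 V) (hM : n < M) (hinj : Function.Injective f) (hf : ∀ a, f a ∈ V)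
    (hv'V : v' ∈ V) (hv' : ∀ a, v' ≠ f a)
    (hO : OverlapCondition n L 0 V (imagesWith (fun a => {f a}) (f b) v')) :
    ReplacementsGrow (morphismRule f) (f b) v' (threshold M) (threshold n) ((M - 1) * L)
      ((M + 1) * L) := by
  have : Nonempty (Fin M) := ⟨b⟩
  have hM2 : 2 ≤ M := by have := h.three_le; omega
  refine ThresholdWords.replacementsGrow (fun _ _ => threshold_of_infix)
    (fun _ _ => h.length_eq _ (hf _)) (h.length_eq _ (hf b)) (h.length_eq _ hv'V) (hv' b).symm
    (fun a m S ha => h.subst_mem_threshold hM hO (hasAlternative_morphismRule hinj hf hv'V hv') ha)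
    (fun ω hω c d hcd hc hd => add_le_of_letter_eq hM2 (hω (d + 1)) hcd (Nat.lt_succ_self d)
      (hinj (hc.trans hd.symm)))
    fun ω hω c => ?_
  obtain ⟨d, hcd, hd, rfl⟩ := exists_letter_eq hM2 (hω _) le_rfl b (c := c)
  exact ⟨d, hcd, hd, rfl⟩

end Growth

end ThresholdWords

open ThresholdWords in
theorem mainTheorem7_general (n : ℕ) :
    (∀ (L : ℕ) (V : Finset (List (Fin n))) (im : Fin n → Fin 3 → List (Fin n))
        (v v' : List (Fin n)),
      4 ≤ n →
      Function.Injective (Function.uncurry im) →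
      (∀ a i, im a i ∈ V) →
      (∃ a i, v = im a i) →
      v' ∈ V → (∀ a i, v' ≠ im a i) →
      CyclicConditions n L V (imagesWith (fun a => Set.range (im a)) v v') →
      ReplacementsGrow (cyclicRule im) v v' (epsThreshold n (eps V L)) (epsThreshold n (eps V L))
        ((3 * n - 3) * L) ((3 * n + 3) * L)) ∧
    (∀ (k L : ℕ) (V : Finset (List (Fin n))) (f : Fin (n + k) → List (Fin n))
        (v v' : List (Fin n)),
      3 ≤ n →
      1 ≤ k →
      Function.Injective f →
      (∀ a, f a ∈ V) →
      (∃ a, v = f a) →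
      v' ∈ V → (∀ a, v' ≠ f a) →
      (∀ u ∈ V, u.length = L) →
      (∀ u ∈ V, per u = u.length) →
      (∀ u ∈ V, ∀ w ∈ V, u ≠ w → u ++ w ∈ threshold n) →
      OverlapCondition n L 0 V (imagesWith (fun a => {f a}) v v') →
      ReplacementsGrow (morphismRule f) v v' (threshold (n + k)) (threshold n)
        ((n + k - 1) * L) ((n + k + 1) * L)) := by
  refine ⟨?_, ?_⟩
  · rintro L V im _ v' hn hinj him ⟨b, i, rfl⟩ hv'V hv' h
    rw [show 3 * n - 3 = 3 * (n - 1) by omega, show 3 * n + 3 = 3 * (n + 1) by omega]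
    exact h.replacementsGrow hn hinj him hv'V hv'
  · rintro k L V f _ v' hn hk hinj hf ⟨b, rfl⟩ hv'V hv' hlength hper hpair hO
    have hV : IsBlockCode n L 0 V := ⟨hn, le_rfl, zero_le_one, Or.inl rfl,
      ⟨_, hf b, _, hv'V, (hv' b).symm⟩, hlength, hper, epsThreshold_zero n ▸ hpair⟩
    exact hV.replacementsGrow (by omega) hinj hf hv'V hv' hO

theorem mainTheorem7 (n : ℕ) (hn : 5 ≤ n) :
    (∀ (L : ℕ) (V : Finset (List (Fin n))) (im : Fin n → Fin 3 → List (Fin n))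
        (v v' : List (Fin n)),
      3 * n + 1 ≤ V.card →
      Function.Injective (Function.uncurry im) →
      (∀ a i, im a i ∈ V) →
      (∃ a i, v = im a i) →
      v' ∈ V → (∀ a i, v' ≠ im a i) →
      ThresholdWords.CyclicConditions n L V
        (ThresholdWords.imagesWith (fun a => Set.range (im a)) v v') →
      (∀ w ∈ ThresholdWords.epsThreshold n (ThresholdWords.eps V L), ∀ S : Set ℕ,
        ThresholdWords.subst
            (ThresholdWords.replaceRule (ThresholdWords.cyclicRule im) v v' S) w ∈
          ThresholdWords.epsThreshold n (ThresholdWords.eps V L)) ∧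
      (∀ ω : ℕ → Fin n,
        (∀ m, ThresholdWords.initialWord ω m ∈
          ThresholdWords.epsThreshold n (ThresholdWords.eps V L)) →
        ThresholdWords.replacementTree (ThresholdWords.cyclicRule im) v v' ω ⊆
          ThresholdWords.epsThreshold n (ThresholdWords.eps V L) ∧
        ThresholdWords.UniformlyGrowing
          (ThresholdWords.replacementTree (ThresholdWords.cyclicRule im) v v' ω)
          ((3 * n - 3) * L) ((3 * n + 3) * L))) ∧
    (∀ (k L : ℕ) (V : Finset (List (Fin n))) (f : Fin (n + k) → List (Fin n))
        (v v' : List (Fin n)),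
      1 ≤ k →
      n + k + 1 ≤ V.card →
      Function.Injective f →
      (∀ a, f a ∈ V) →
      (∃ a, v = f a) →
      v' ∈ V → (∀ a, v' ≠ f a) →
      ThresholdWords.MorphismConditions n L V →
      ThresholdWords.OverlapCondition n L 0 V
        (ThresholdWords.imagesWith (fun a => {f a}) v v') →
      (∀ w ∈ ThresholdWords.threshold (n + k), ∀ S : Set ℕ,
        ThresholdWords.subst
            (ThresholdWords.replaceRule (ThresholdWords.morphismRule f) v v' S) w ∈
          ThresholdWords.threshold n) ∧
      (∀ ω : ℕ → Fin (n + k),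
        (∀ m, ThresholdWords.initialWord ω m ∈ ThresholdWords.threshold (n + k)) →
        ThresholdWords.replacementTree (ThresholdWords.morphismRule f) v v' ω ⊆
          ThresholdWords.threshold n ∧
        ThresholdWords.UniformlyGrowing
          (ThresholdWords.replacementTree (ThresholdWords.morphismRule f) v v' ω)
          ((n + k - 1) * L) ((n + k + 1) * L))) :=
  ⟨fun L V im v v' _ hinj him hv hv'V hv' h =>
    (mainTheorem7_general n).1 L V im v v' (by omega) hinj him hv hv'V hv' h,
  fun k L V f v v' hk _ hinj hf hv hv'V hv' h hO => (mainTheorem7_general n).2 k L V f v v'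
    (by omega) hk hinj hf hv hv'V hv' h.length_eq h.per_eq h.pair hO⟩
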